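/- Let $|\Psi\rangle_{\tilde A\tilde B\tilde R}$ be a pure (normalised) state of three finite-dimensional quantum systems of dimensions $d_{\tilde A},d_{\tilde B},d_{\tilde R}$, with reduced states $\rho_{\tilde B}$, $\rho_{\tilde R}$, etc. Let $D>0$ be such that $\operatorname{Tr}\rho_{\tilde B}^2\le \frac1D$, let $L\ge 1$ be an integer, and put $N=\lfloor d_{\tilde A}/L\rfloor$, $L'=d_{\tilde A}-NL<L$ and $$\beta := 2\sqrt{L\frac{d_{\tilde R}}{D}}+2\frac{L}{d_{\tilde A}} .$$ Consider measurements on $\tilde A$ consisting of $N$ orthogonal projectors of rank $L$ and one of rank $L'$ (summing to the identity), each followed by an isometric map of its range into an $L$-dimensional system $A_1$; denote the resulting Kraus operators by $P_j:\tilde A\to A_1$, $j=0,\dots,N$, the outcome probabilities by $p_j=\langle\Psi|(P_j^\dagger P_j\otimes I)|\Psi\rangle$, and the post-measurement states by $|\Psi^j\rangle=p_j^{-1/2}(P_j\otimes I)|\Psi\rangle$, with reduced states $\rho^j_{A_1\tilde R}$. The quantum error of the measurement is $$Q_e=\sum_{j} p_j\bigl\|\rho^j_{A_1\tilde R}-\tau_{A_1}\otimes\rho_{\tilde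 R}\bigr\|_1 ,$$ the sum being over all outcomes (terms with $p_j=0$ count as $0$), where $\tau_{A_1}$ is the maximally mixed state on $A_1$ and $\|X\|_1=\operatorname{Tr}\sqrt{X^\dagger X}$. Then: 1. There exists such a measurement with $Q_e\le\beta$. 2. There is a state merging protocol for $\Psi$ with entanglement cost $-\log L$ and error at most $2\sqrt{\beta}$: an LOCC operation $\mathcal M$ (local operations and finitely many rounds of classical communication) $\mathcal M:\tilde A\otimes\tilde B\to A_1\otimes B_1\tilde B'\tilde B$, where $\tilde B'$ is a copy of $\tilde A$ held by Bob, such that the output state $\rho=(\mathcal M\otimes\mathrm{id}_{\tilde R})(\Psi)$ satisfies $$F\bigl(\rho,\,(\Phi_L)_{A_1B_1}\otimes\Psi_{\tilde B'\tilde B\tilde R}\bigr)\ge 1-2\sqrt{\beta}\quad\text{and}\quad \bigl\|\rho-(\Phi_L)_{A_1B_1}\otimes\Psi_{\tilde B'\tilde B\tilde R}\bigr\|_1\le 2\sqrt{\beta},$$ where $\Phi_L$ is the maximally entangled state of Schmidt rank $L$ and $F(\rho,\sigma)=\bigl(\operatorname{Tr}\sqrt{\sqrt\rho\,\sigma\sqrt\rho}\bigr)^2$.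 3. In fact, a random such measurement achieves the bound on average: if $(Q_j)_j$ is any fixed measurement of the above kind and $U$ is a Haar-distributed unitary on $\tilde A$, then the expectation of the quantum error of the measurement with Kraus operators $P_j=Q_jU$ is at most $\beta$. -/

import Mathlib

open Matrix MeasureTheory
open scoped Kronecker

namespace Merging

noncomputable section

/-! ### States, trace norm, fidelity

A finite-dimensional quantum system is a finite index set labelling an orthonormal basis of its
Hilbert space; composite systems are products of index sets, operators are complex matrices. -/

/-- The operator `|v⟩⟨v|` of a vector `v`. -/
def ketbra {X : Type} (v : X → ℂ) : Matrix X X ℂ := vecMulVec v (star v)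

/-- `v` is a state vector, i.e. `⟨v|v⟩ = 1`. -/
def IsStateVector {X : Type} [Fintype X] (v : X → ℂ) : Prop := star v ⬝ᵥ v = 1

/-- The square root of a positive semidefinite matrix (functional calculus). -/
def psdSqrt {X : Type} [Fintype X] [DecidableEq X] (M : Matrix X X ℂ) : Matrix X X ℂ :=
  cfc Real.sqrt M

/-- The trace norm `‖M‖₁ = Tr √(Mᴴ M)`. -/
def traceNorm {X : Type} [Fintype X] [DecidableEq X] (M : Matrix X X ℂ) : ℝ :=
  (psdSqrt (Mᴴ * M)).trace.re

/-- The fidelity `F(ρ, σ) = (Tr √(√ρ σ √ρ))²`. -/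
def fidelity {X : Type} [Fintype X] [DecidableEq X] (ρ σ : Matrix X X ℂ) : ℝ :=
  (psdSqrt (psdSqrt ρ * σ * psdSqrt ρ)).trace.re ^ 2

/-- The maximally mixed state `τ` of dimension `L`. -/
def maxMixed (L : ℕ) : Matrix (Fin L) (Fin L) ℂ := (L : ℂ)⁻¹ • 1

/-- The maximally entangled state vector `L^(-1/2) ∑ i, |i⟩|i⟩` of Schmidt rank `L`. -/
def maxEntangled (L : ℕ) : Fin L × Fin L → ℂ :=
  fun x => if x.1 = x.2 then ((Real.sqrt L)⁻¹ : ℂ) else 0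

/-- Reduced operator on the first and third of three systems. -/
def reduce13 {A B R : Type} [Fintype B] (M : Matrix (A × B × R) (A × B × R) ℂ) :
    Matrix (A × R) (A × R) ℂ :=
  fun x y => ∑ b, M (x.1, b, x.2) (y.1, b, y.2)

/-- Reduced operator on the second of three systems. -/
def reduce2 {A B R : Type} [Fintype A] [Fintype R] (M : Matrix (A × B × R) (A × B × R) ℂ) :
    Matrix B B ℂ :=
  fun b b' => ∑ a, ∑ r, M (a, b, r) (a, b', r)

/-- Reduced operator on the third of three systems. -/
def reduce3 {A B R : Type} [Fintype A] [Fintype B] (M : Matrix (A × B × R) (A × B × R) ℂ) :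
    Matrix R R ℂ :=
  fun r r' => ∑ a, ∑ b, M (a, b, r) (a, b, r')

/-! ### Alice's measurement and its quantum error -/

section Measurement

variable {A B R : Type} [Fintype A] [DecidableEq A] [Fintype B] [DecidableEq B]
  [Fintype R] [DecidableEq R]

/-- The probability `p = ⟨Ψ| (Pᴴ P ⊗ I) |Ψ⟩` of the outcome with Kraus operator `P` on `A`. -/
def outcomeProb {X : Type} [Fintype X] (P : Matrix X A ℂ) (ψ : A × B × R → ℂ) : ℝ :=
  (star ψ ⬝ᵥ (((Pᴴ * P) ⊗ₖ (1 : Matrix (B × R) (B × R) ℂ)) *ᵥ ψ)).re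

/-- The post-measurement vector `p^(-1/2) (P ⊗ I) |Ψ⟩` (the zero vector if `p = 0`). -/
def postState {X : Type} [Fintype X] (P : Matrix X A ℂ) (ψ : A × B × R → ℂ) : X × B × R → ℂ :=
  ((Real.sqrt (outcomeProb P ψ))⁻¹ : ℂ) •
    ((P ⊗ₖ (1 : Matrix (B × R) (B × R) ℂ)) *ᵥ ψ)

/-- The quantum error `∑ j, p_j ‖ρ^j_{A₁R} - τ_{A₁} ⊗ ρ_R‖₁` of a measurement with Kraus
operators `P j : A → A₁`, where `A₁` has dimension `L`. -/
def quantumError {J : Type} [Fintype J] {L : ℕ} (P : J → Matrix (Fin L) A ℂ)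
    (ψ : A × B × R → ℂ) : ℝ :=
  ∑ j, outcomeProb (P j) ψ *
    traceNorm (reduce13 (ketbra (postState (P j) ψ)) - maxMixed L ⊗ₖ reduce3 (ketbra ψ))

/-- `P` describes a measurement of `A` consisting of `N = ⌊d_A / L⌋` orthogonal projectors of rank
`L` (outcomes `some j`) and one of rank `d_A - N L` (outcome `none`), each of them followed by an
isometric map of its range into an `L`-dimensional space: the projectors are `(P j)ᴴ * P j`. -/
structure IsRankMeasurement {L : ℕ}
    (P : Option (Fin (Fintype.card A / L)) → Matrix (Fin L) A ℂ) : Prop where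
  proj : ∀ j, IsStarProjection ((P j)ᴴ * P j)
  rank_some : ∀ j, ((P (some j))ᴴ * P (some j)).rank = L
  rank_none : ((P none)ᴴ * P none).rank = Fintype.card A - Fintype.card A / L * L
  complete : ∑ j, (P j)ᴴ * P j = 1

end Measurement

/-! ### Haar measure on the unitary group -/

section Haar

variable (A : Type) [Fintype A] [DecidableEq A]

instance : MeasurableSpace (unitaryGroup A ℂ) := borel _

instance : BorelSpace (unitaryGroup A ℂ) := ⟨rfl⟩

instance : CompactSpace (unitaryGroup A ℂ) := by
  refine (isCompact_iff_compactSpace (s := (unitaryGroup A ℂ : Set (Matrix A A ℂ)))).mp ?_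
  have hK : IsCompact (Set.pi Set.univ (fun _ : A => Set.pi Set.univ
      (fun _ : A => Metric.closedBall (0 : ℂ) 1))) :=
    isCompact_univ_pi fun _ => isCompact_univ_pi fun _ => isCompact_closedBall _ _
  refine IsCompact.of_isClosed_subset (X := Matrix A A ℂ) hK ?_ ?_
  · have : ((unitaryGroup A ℂ : Submonoid (Matrix A A ℂ)) : Set (Matrix A A ℂ)) =
        {U | star U * U = 1 ∧ U * star U = 1} := rfl
    rw [this]
    exact (isClosed_eq (by fun_prop) continuous_const).inter
      (isClosed_eq (by fun_prop) continuous_const)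
  · intro U hU i _ j _
    simpa using entry_norm_bound_of_unitary hU i j

/-- The Haar probability measure on the unitary group of `A`. -/
def unitaryHaar : Measure (unitaryGroup A ℂ) := Measure.haarMeasure ⊤

end Haar

/-! ### LOCC and state merging -/

/-- The map `X ↦ K X Kᴴ`. -/
def conjMap {X Y : Type} [Fintype X] (K : Matrix Y X ℂ) : Matrix X X ℂ →ₗ[ℂ] Matrix Y Y ℂ where
  toFun M := K * M * Kᴴ
  map_add' M N := by rw [Matrix.mul_add, Matrix.add_mul]
  map_smul' c M := by simp

/-- Operations `A ⊗ B → A' ⊗ B'` of two parties by local operations and finitely many rounds of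
classical communication. Either nothing (more) is done, or one party performs a local quantum
measurement with finitely many Kraus operators `K j` and announces the outcome `j`, upon which the
parties go on with an LOCC operation that depends on `j`; the outcome record is finally discarded.
Operations that forget or withhold an outcome are included, since what follows need not
depend on `j`. -/
inductive IsLOCC (A' B' : Type) : (A B : Type) →
    (Matrix (A × B) (A × B) ℂ →ₗ[ℂ] Matrix (A' × B') (A' × B') ℂ) → Prop
  | done : IsLOCC A' B' A' B' LinearMap.id
  | alice {A B C J : Type} [Fintype A] [DecidableEq A] [Fintype B] [DecidableEq B]
      [Fintype C] [Fintype J] (K : J → Matrix C A ℂ) (hK : ∑ j, (K j)ᴴ * K j = 1)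
      (M : J → (Matrix (C × B) (C × B) ℂ →ₗ[ℂ] Matrix (A' × B') (A' × B') ℂ))
      (hM : ∀ j, IsLOCC A' B' C B (M j)) :
      IsLOCC A' B' A B (∑ j, M j ∘ₗ conjMap (K j ⊗ₖ (1 : Matrix B B ℂ)))
  | bob {A B C J : Type} [Fintype A] [DecidableEq A] [Fintype B] [DecidableEq B]
      [Fintype C] [Fintype J] (K : J → Matrix C B ℂ) (hK : ∑ j, (K j)ᴴ * K j = 1)
      (M : J → (Matrix (A × C) (A × C) ℂ →ₗ[ℂ] Matrix (A' × B') (A' × B') ℂ))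
      (hM : ∀ j, IsLOCC A' B' A C (M j)) :
      IsLOCC A' B' A B (∑ j, M j ∘ₗ conjMap ((1 : Matrix A A ℂ) ⊗ₖ K j))

/-- `(M ⊗ id_R)(ρ)`: the map `M` applied to each block of `ρ`. -/
def tensorId {X Y R : Type} (M : Matrix X X ℂ →ₗ[ℂ] Matrix Y Y ℂ)
    (ρ : Matrix (X × R) (X × R) ℂ) : Matrix (Y × R) (Y × R) ℂ :=
  fun y z => M (fun x x' => ρ (x, y.2) (x', z.2)) y.1 z.1

section Merge

variable {A B R : Type} [Fintype A] [DecidableEq A] [Fintype B] [DecidableEq B]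
  [Fintype R] [DecidableEq R]

/-- The vector `Ψ_{ABR} ⊗ (Φ_K)_{A₀B₀}`, with systems grouped as `(A A₀)(B B₀) R`. -/
def mergeInput (K : ℕ) (ψ : A × B × R → ℂ) : ((A × Fin K) × (B × Fin K)) × R → ℂ :=
  fun x => ψ (x.1.1.1, x.1.2.1, x.2) * maxEntangled K (x.1.1.2, x.1.2.2)

/-- The vector `(Φ_L)_{A₁B₁} ⊗ Ψ_{B'BR}`, with systems grouped as `(A₁)(B₁ B' B) R`; Bob's
system `B'` is a copy of `A`. -/
def mergeTarget (L : ℕ) (ψ : A × B × R → ℂ) : (Fin L × (Fin L × A × B)) × R → ℂ :=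
  fun x => maxEntangled L (x.1.1, x.1.2.1) * ψ (x.1.2.2.1, x.1.2.2.2, x.2)

/-- The output `(M ⊗ id_R)(Ψ ⊗ Φ_K)` of a joint operation `M : (A A₀)(B B₀) → (A₁)(B₁ B' B)`. -/
def mergeOutput {K L : ℕ} (ψ : A × B × R → ℂ)
    (M : Matrix ((A × Fin K) × (B × Fin K)) ((A × Fin K) × (B × Fin K)) ℂ →ₗ[ℂ]
      Matrix (Fin L × (Fin L × A × B)) (Fin L × (Fin L × A × B)) ℂ) :
    Matrix ((Fin L × (Fin L × A × B)) × R) ((Fin L × (Fin L × A × B)) × R) ℂ :=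
  tensorId M (ketbra (mergeInput K ψ))

/-- `M` is state merging of `Ψ` with error `ε`, consuming `Φ_K` and producing `Φ_L` (its
entanglement cost is `log K - log L`). -/
def IsStateMerging {K L : ℕ} (ψ : A × B × R → ℂ)
    (M : Matrix ((A × Fin K) × (B × Fin K)) ((A × Fin K) × (B × Fin K)) ℂ →ₗ[ℂ]
      Matrix (Fin L × (Fin L × A × B)) (Fin L × (Fin L × A × B)) ℂ) (ε : ℝ) : Prop :=
  IsLOCC (Fin L) (Fin L × A × B) (A × Fin K) (B × Fin K) M ∧
    1 - ε ≤ fidelity (mergeOutput ψ M) (ketbra (mergeTarget L ψ))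

end Merge

/-- The bound `2 √(L d_R / D) + 2 L / d_A` on the quantum error. -/
def errorBound (L dA dR : ℕ) (D : ℝ) : ℝ := 2 * Real.sqrt (L * (dR / D)) + 2 * (L / dA)

end

end Merging

namespace Merging

open scoped ComplexOrder

noncomputable section

/-! ### Square roots of positive semidefinite matrices -/

section SquareRoot

variable {X Y Z : Type} [Fintype X] [DecidableEq X] [Fintype Y] [DecidableEq Y] [Fintype Z]
  [DecidableEq Z]

/-! Write `d` for the dimension of `A`, `c = L / d` and `T = τ ⊗ ρ_R`, and let `S` be the
unnormalised state on `A₁R` after a rank-`L` outcome of the measurement rotated by a Haar unitary.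
The mean of `S` is `c T`. Second moments of `Uᴴ G U` for a projector `G` give `𝔼 ‖S - c T‖₂² ≤ c² Tr
ρ_AR²`, and purity of `Ψ` turns `Tr ρ_AR²` into `Tr ρ_B² ≤ 1 / D`. Cauchy-Schwarz on the `L
d_R`-dimensional space and concavity of the root yield `𝔼 ‖S - c T‖₁ ≤ c √(L d_R / D)`; replacing
the weight `c` by the actual probability `Tr S` costs a factor 2. There are at most `d / L = 1 / c`
such outcomes. The leftover outcome contributes at most twice its probability, whose mean is below
`L / d`. This bounds the average error (`integral_quantumError_le`), and some unitary does no worse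
than the average.

For merging, `Φ_L ⊗ Ψ` with Bob holding `B₁B'B` purifies `τ ⊗ ρ_R`. If outcome `j` leaves a reduced
state at trace distance `x_j` from `τ ⊗ ρ_R`, the Powers-Størmer inequality and Uhlmann's theorem
give Bob an isometry reaching squared overlap at least `(1 - x_j / 2)² ≥ 1 - x_j` with the target
(`exists_decoder`). Fidelity with a pure state is linear, so averaging over outcomes gives fidelity
at least `1 - β`, and the Fuchs-van de Graaf inequality gives trace distance at most `2 √β`
(`exists_isStateMerging`). -/

theorem exists_spectral_cfc {H : Matrix X X ℂ} (hH : H.IsHermitian) :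
    ∃ (E : Matrix X X ℂ) (l : X → ℝ), Eᴴ * E = 1 ∧ E * Eᴴ = 1 ∧
      H = E * diagonal (fun i => (l i : ℂ)) * Eᴴ ∧
      ∀ f : ℝ → ℝ, cfc f H = E * diagonal (fun i => (f (l i) : ℂ)) * Eᴴ := by
  refine ⟨hH.eigenvectorUnitary, hH.eigenvalues, ?_, ?_, ?_, fun f => ?_⟩
  · exact Unitary.coe_star_mul_self hH.eigenvectorUnitary
  · exact Unitary.coe_mul_star_self hH.eigenvectorUnitary
  · conv_lhs => rw [hH.spectral_theorem]
    rfl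
  · rw [hH.cfc_eq]
    rfl

theorem posSemidef_conj_diagonal (E : Matrix X X ℂ) {l : X → ℝ} (hl : ∀ i, 0 ≤ l i) :
    (E * diagonal (fun i => (l i : ℂ)) * Eᴴ).PosSemidef := by
  refine PosSemidef.mul_mul_conjTranspose_same ?_ E
  rw [posSemidef_diagonal_iff]
  intro i
  exact_mod_cast hl i

theorem psdSqrt_posSemidef {H : Matrix X X ℂ} (hH : H.PosSemidef) : (psdSqrt H).PosSemidef := by
  obtain ⟨E, l, -, -, -, h⟩ := exists_spectral_cfc hH.1
  rw [psdSqrt, h]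
  exact posSemidef_conj_diagonal E fun i => Real.sqrt_nonneg _

theorem spectral_nonneg {H E : Matrix X X ℂ} {l : X → ℝ} (hH : H.PosSemidef) (hE : Eᴴ * E = 1)
    (h : H = E * diagonal (fun i => (l i : ℂ)) * Eᴴ) (i : X) : 0 ≤ l i := by
  have h1 : Eᴴ * H * E = diagonal (fun i => (l i : ℂ)) := by
    rw [h]
    calc Eᴴ * (E * diagonal (fun i => (l i : ℂ)) * Eᴴ) * E
        = (Eᴴ * E) * diagonal (fun i => (l i : ℂ)) * (Eᴴ * E) := by simp only [Matrix.mul_assoc]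
      _ = _ := by rw [hE, Matrix.one_mul, Matrix.mul_one]
  have h2 := hH.conjTranspose_mul_mul_same E
  rw [h1, posSemidef_diagonal_iff] at h2
  exact_mod_cast h2 i

theorem conj_diagonal_mul {E : Matrix X X ℂ} (hE : Eᴴ * E = 1) (f g : X → ℂ) :
    E * diagonal f * Eᴴ * (E * diagonal g * Eᴴ) = E * diagonal (fun i => f i * g i) * Eᴴ := by
  calc E * diagonal f * Eᴴ * (E * diagonal g * Eᴴ)
      = E * diagonal f * (Eᴴ * E) * diagonal g * Eᴴ := by simp only [Matrix.mul_assoc]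
    _ = _ := by rw [hE, Matrix.mul_one, Matrix.mul_assoc E, diagonal_mul_diagonal]

theorem psdSqrt_mul_self {H : Matrix X X ℂ} (hH : H.PosSemidef) : psdSqrt H * psdSqrt H = H := by
  obtain ⟨E, l, h1, -, h3, h⟩ := exists_spectral_cfc hH.1
  have hl := spectral_nonneg hH h1 h3
  rw [psdSqrt, h, conj_diagonal_mul h1]
  conv_rhs => rw [h3]
  congr 3
  ext i
  rw [← Complex.ofReal_mul, Real.mul_self_sqrt (hl i)]

/-- `√(x²) = x` on the spectrum of `K`, which is nonnegative. This is uniqueness of the positive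
root, the tool for identifying every explicit square root below. -/
theorem psdSqrt_of_mul_self {K : Matrix X X ℂ} (hK : K.PosSemidef) : psdSqrt (K * K) = K := by
  have hsa : IsSelfAdjoint K := hK.1
  have hfin : (spectrum ℝ K).Finite := by
    rw [hK.1.spectrum_real_eq_range_eigenvalues]
    exact Set.finite_range _
  have h1 : K * K = cfc (fun x : ℝ => x ^ 2) K := by
    rw [cfc_pow_id (R := ℝ) K 2, sq]
  rw [psdSqrt, h1, ← cfc_comp' Real.sqrt (fun x : ℝ => x ^ 2) K]
  conv_rhs => rw [← cfc_id ℝ K]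
  refine cfc_congr fun x hx => ?_
  have hx0 : 0 ≤ x := by
    rw [hK.1.spectrum_real_eq_range_eigenvalues] at hx
    obtain ⟨i, rfl⟩ := hx
    exact hK.eigenvalues_nonneg i
  simp [Real.sqrt_sq hx0]

theorem psdSqrt_eq {H K : Matrix X X ℂ} (hK : K.PosSemidef) (h : K * K = H) : psdSqrt H = K := by
  rw [← h, psdSqrt_of_mul_self hK]

theorem psdSqrt_smul {H : Matrix X X ℂ} (hH : H.PosSemidef) {c : ℝ} (hc : 0 ≤ c) :
    psdSqrt ((c ^ 2 : ℝ) • H) = c • psdSqrt H := by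
  refine psdSqrt_eq ((psdSqrt_posSemidef hH).smul hc) ?_
  rw [Matrix.smul_mul, Matrix.mul_smul, psdSqrt_mul_self hH, smul_smul, sq]

end SquareRoot

/-! ### Hilbert-Schmidt norm -/

section HilbertSchmidt

variable {X Y Z : Type} [Fintype X] [Fintype Y] [Fintype Z]

theorem posSemidef_trace_re_nonneg {H : Matrix X X ℂ} (hH : H.PosSemidef) : 0 ≤ H.trace.re := by
  have := hH.trace_nonneg
  exact (Complex.le_def.mp this).1

theorem posSemidef_trace_eq {H : Matrix X X ℂ} (hH : H.PosSemidef) :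
    (H.trace.re : ℂ) = H.trace := by
  have := hH.trace_nonneg
  apply Complex.ext
  · simp
  · simpa using (Complex.le_def.mp this).2

/-- The squared Hilbert-Schmidt norm. -/
def hsSq (M : Matrix X Y ℂ) : ℝ := ∑ i, ∑ j, ‖M i j‖ ^ 2

theorem hsSq_nonneg (M : Matrix X Y ℂ) : 0 ≤ hsSq M :=
  Finset.sum_nonneg fun _ _ => Finset.sum_nonneg fun _ _ => sq_nonneg _

theorem trace_conjTranspose_mul (M N : Matrix X Y ℂ) :
    (Mᴴ * N).trace = ∑ i, ∑ j, star (M i j) * N i j := by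
  rw [Finset.sum_comm]
  simp [Matrix.trace, Matrix.mul_apply]

theorem trace_conjTranspose_mul_self (M : Matrix X Y ℂ) : (Mᴴ * M).trace = (hsSq M : ℂ) := by
  rw [trace_conjTranspose_mul, hsSq]
  push_cast
  refine Finset.sum_congr rfl fun i _ => Finset.sum_congr rfl fun j _ => ?_
  rw [← Complex.conj_mul']
  rfl

theorem hsSq_eq (M : Matrix X Y ℂ) : hsSq M = (Mᴴ * M).trace.re := by
  rw [trace_conjTranspose_mul_self, Complex.ofReal_re]

theorem hsSq_conjTranspose (M : Matrix X Y ℂ) : hsSq Mᴴ = hsSq M := by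
  rw [hsSq, hsSq, Finset.sum_comm]
  simp

theorem norm_trace_conjTranspose_mul_le (M N : Matrix X Y ℂ) :
    ‖(Mᴴ * N).trace‖ ≤ Real.sqrt (hsSq M) * Real.sqrt (hsSq N) := by
  rw [trace_conjTranspose_mul, ← Finset.sum_product', hsSq, hsSq, ← Finset.sum_product',
    ← Finset.sum_product']
  refine (norm_sum_le _ _).trans ?_
  simp only [norm_mul, norm_star]
  exact Real.sum_mul_le_sqrt_mul_sqrt _ _ _

end HilbertSchmidt

/-! ### Polar decompositions -/

section Polar

open scoped Matrix.Norms.L2Operator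

variable {X Y Z : Type} [Fintype X] [DecidableEq X] [Fintype Y] [DecidableEq Y] [Fintype Z]
  [DecidableEq Z]

theorem norm_le_one_of_isIdempotentElem {P : Matrix X X ℂ} (h1 : Pᴴ = P) (h2 : P * P = P) :
    ‖P‖ ≤ 1 := by
  have h := l2_opNorm_conjTranspose_mul_self P
  rw [h1, h2] at h
  by_contra! hc
  nlinarith

theorem conj_diagonal_conjTranspose (E : Matrix X X ℂ) (l : X → ℝ) :
    (E * diagonal (fun i => (l i : ℂ)) * Eᴴ)ᴴ = E * diagonal (fun i => (l i : ℂ)) * Eᴴ := by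
  rw [conjTranspose_mul, conjTranspose_mul, conjTranspose_conjTranspose, diagonal_conjTranspose,
    Matrix.mul_assoc]
  congr 3
  ext i
  simp

omit [DecidableEq Y] in
-- `W = M S` with `S` the pseudo-inverse of `|M|`. Then `Wᴴ W` is the support projection `P` of
-- `|M|`, so `W` is a contraction whatever the dimensions of `X` and `Y`.
theorem exists_contraction_polar (M : Matrix Y X ℂ) :
    ∃ W : Matrix Y X ℂ, ‖W‖ ≤ 1 ∧ M = W * psdSqrt (Mᴴ * M) ∧ Wᴴ * M = psdSqrt (Mᴴ * M) := by
  have hpsd := posSemidef_conjTranspose_mul_self M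
  obtain ⟨E, l, h1, h2, h3, h⟩ := exists_spectral_cfc hpsd.1
  have hl := spectral_nonneg hpsd h1 h3
  set S : Matrix X X ℂ := E * diagonal (fun i => (((Real.sqrt (l i))⁻¹ : ℝ) : ℂ)) * Eᴴ with hS
  set P : Matrix X X ℂ := E * diagonal (fun i => ((if l i = 0 then 0 else 1 : ℝ) : ℂ)) * Eᴴ with hP
  have hSs : Sᴴ = S := conj_diagonal_conjTranspose _ _
  have hPs : Pᴴ = P := conj_diagonal_conjTranspose _ _
  have hPP : P * P = P := by
    rw [hP, conj_diagonal_mul h1]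
    congr 3
    ext i
    split_ifs <;> simp
  have hHP : Mᴴ * M * P = Mᴴ * M := by
    rw [h3, hP, conj_diagonal_mul h1]
    congr 3
    ext i
    split_ifs with hi <;> simp [hi]
  have hSH : S * (Mᴴ * M) = psdSqrt (Mᴴ * M) := by
    rw [psdSqrt, h, hS]
    conv_lhs => rw [h3]
    rw [conj_diagonal_mul h1]
    congr 3
    ext i
    rw [← Complex.ofReal_mul]
    congr 1
    rcases (hl i).eq_or_lt with h0 | h0
    · simp [← h0]
    · rw [inv_mul_eq_iff_eq_mul₀ (Real.sqrt_pos.mpr h0).ne', Real.mul_self_sqrt h0.le]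
  have hSq : S * psdSqrt (Mᴴ * M) = P := by
    rw [psdSqrt, h, hS, conj_diagonal_mul h1]
    congr 3
    ext i
    rw [← Complex.ofReal_mul]
    congr 1
    rcases (hl i).eq_or_lt with h0 | h0
    · simp [← h0]
    · rw [inv_mul_cancel₀ (Real.sqrt_pos.mpr h0).ne', if_neg h0.ne']
  -- `P` fixes `Mᴴ M`, so the Gram matrix of `M - M P` vanishes.
  have hMP : M - M * P = 0 := by
    rw [← conjTranspose_mul_self_eq_zero, conjTranspose_sub, conjTranspose_mul, hPs,
      Matrix.sub_mul, Matrix.mul_sub, Matrix.mul_sub]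
    have e1 : Mᴴ * (M * P) = Mᴴ * M := by rw [← Matrix.mul_assoc, hHP]
    rw [Matrix.mul_assoc P, Matrix.mul_assoc P, e1]
    simp
  refine ⟨M * S, ?_, ?_, ?_⟩
  · have hn := l2_opNorm_conjTranspose_mul_self (M * S)
    have e : (M * S)ᴴ * (M * S) = P := by
      rw [conjTranspose_mul, hSs, ← hSq, ← hSH]
      simp only [Matrix.mul_assoc]
      rw [← Matrix.mul_assoc Mᴴ M S, ← Matrix.mul_assoc S (Mᴴ * M) S, hSH]
      have : psdSqrt (Mᴴ * M) * S = S * psdSqrt (Mᴴ * M) := by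
        rw [psdSqrt, h, hS, conj_diagonal_mul h1, conj_diagonal_mul h1]
        simp only [mul_comm]
      rw [this]
    rw [e] at hn
    have := norm_le_one_of_isIdempotentElem hPs hPP
    by_contra! hc
    nlinarith
  · rw [Matrix.mul_assoc, hSq]
    exact sub_eq_zero.mp hMP
  · rw [conjTranspose_mul, hSs, Matrix.mul_assoc, hSH]

/-- The columns of `M E` with nonzero singular value, once normalised, are orthonormal; the
dimension bound leaves room to complete them. A genuine isometry is needed because Bob's decoder has
to be a valid quantum operation. -/
theorem exists_isometry_polar (hXY : Fintype.card X ≤ Fintype.card Y) (M : Matrix Y X ℂ) :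
    ∃ V : Matrix Y X ℂ, Vᴴ * V = 1 ∧ M = V * psdSqrt (Mᴴ * M) := by
  have hpsd := posSemidef_conjTranspose_mul_self M
  obtain ⟨E, l, h1, h2, h3, h⟩ := exists_spectral_cfc hpsd.1
  have hl := spectral_nonneg hpsd h1 h3
  obtain ⟨e⟩ := Function.Embedding.nonempty_of_card_le hXY
  set G : Matrix Y X ℂ := M * E with hG
  have hGG : Gᴴ * G = diagonal (fun i => (l i : ℂ)) := by
    rw [hG, conjTranspose_mul, Matrix.mul_assoc, ← Matrix.mul_assoc Mᴴ, h3]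
    calc Eᴴ * (E * diagonal (fun i => (l i : ℂ)) * Eᴴ * E)
        = (Eᴴ * E) * diagonal (fun i => (l i : ℂ)) * (Eᴴ * E) := by simp only [Matrix.mul_assoc]
      _ = _ := by rw [h1, Matrix.one_mul, Matrix.mul_one]
  have hGG' : ∀ i j, ∑ y, star (G y i) * G y j = if i = j then (l i : ℂ) else 0 := by
    intro i j
    have := congrFun (congrFun hGG i) j
    rwa [Matrix.mul_apply, diagonal_apply] at this
  let f : X → EuclideanSpace ℂ Y := fun i =>
    WithLp.toLp 2 fun y => (((Real.sqrt (l i))⁻¹ : ℝ) : ℂ) * G y i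
  let v : Y → EuclideanSpace ℂ Y := Function.extend e f 0
  have hv : ∀ i, v (e i) = f i := fun i => e.injective.extend_apply f 0 i
  let s : Set Y := e '' {i | l i ≠ 0}
  have hon : Orthonormal ℂ (s.domRestrict v) := by
    classical
    rw [orthonormal_iff_ite]
    rintro ⟨_, i, hi, rfl⟩ ⟨_, j, hj, rfl⟩
    have hi0 : l i ≠ 0 := hi
    have hiff : ((⟨e i, i, hi, rfl⟩ : s) = ⟨e j, j, hj, rfl⟩) ↔ i = j :=
      Subtype.ext_iff.trans e.injective.eq_iff
    simp only [Set.domRestrict_apply, hv]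
    rw [EuclideanSpace.inner_eq_star_dotProduct, if_congr hiff rfl rfl]
    have : (f j).ofLp ⬝ᵥ star (f i).ofLp =
        (((Real.sqrt (l i))⁻¹ : ℝ) : ℂ) * (((Real.sqrt (l j))⁻¹ : ℝ) : ℂ) *
          ∑ y, star (G y i) * G y j := by
      rw [Finset.mul_sum]
      simp only [dotProduct, f, Pi.star_apply, star_mul', RCLike.star_def, Complex.conj_ofReal]
      refine Finset.sum_congr rfl fun y _ => by ring
    rw [this, hGG']
    split_ifs with hij
    · subst hij
      rw [← Complex.ofReal_mul, ← Complex.ofReal_mul, ← mul_inv, Real.mul_self_sqrt (hl i),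
        inv_mul_cancel₀ hi0, Complex.ofReal_one]
    · simp
  obtain ⟨b, hb⟩ := hon.exists_orthonormalBasis_extension_of_card_eq (by simp)
  let V : Matrix Y X ℂ := fun y i => b (e i) y
  have hVV : Vᴴ * V = 1 := by
    ext i j
    have hij := orthonormal_iff_ite.mp b.orthonormal (e i) (e j)
    rw [EuclideanSpace.inner_eq_star_dotProduct] at hij
    rw [Matrix.mul_apply, Matrix.one_apply]
    simp only [e.injective.eq_iff] at hij
    rw [← hij]
    simp only [dotProduct, V, Pi.star_apply]
    exact Finset.sum_congr rfl fun y _ => mul_comm _ _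
  have hVd : V * diagonal (fun i => ((Real.sqrt (l i) : ℝ) : ℂ)) = G := by
    ext y i
    rw [mul_diagonal]
    -- A column with zero singular value vanishes, so the arbitrary completing vector there is
    -- multiplied by 0.
    by_cases hi : l i = 0
    · have h0 : ∀ y, G y i = 0 := by
        have := hGG' i i
        rw [if_pos rfl, hi] at this
        have h' : ∑ y, ‖G y i‖ ^ 2 = 0 := by
          have h'' : ((∑ y, ‖G y i‖ ^ 2 : ℝ) : ℂ) = 0 := by
            rw [← Complex.ofReal_zero, ← this]
            push_cast
            refine Finset.sum_congr rfl fun y _ => ?_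
            rw [← Complex.conj_mul']
            rfl
          exact_mod_cast h''
        intro y
        have := (Finset.sum_eq_zero_iff_of_nonneg fun y _ => sq_nonneg _).mp h' y
          (Finset.mem_univ y)
        simpa using this
      rw [hi, h0]
      simp
    · have : V y i = (((Real.sqrt (l i))⁻¹ : ℝ) : ℂ) * G y i := by
        change (b (e i)).ofLp y = _
        rw [hb (e i) ⟨i, hi, rfl⟩, hv]
      rw [this, mul_right_comm, ← Complex.ofReal_mul, inv_mul_cancel₀, Complex.ofReal_one, one_mul]
      exact (Real.sqrt_pos.mpr ((hl i).lt_of_ne' hi)).ne'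
  refine ⟨V * Eᴴ, ?_, ?_⟩
  · rw [conjTranspose_mul, conjTranspose_conjTranspose, Matrix.mul_assoc, ← Matrix.mul_assoc Vᴴ,
      hVV, Matrix.one_mul, h2]
  · rw [psdSqrt, h, Matrix.mul_assoc, ← Matrix.mul_assoc Eᴴ, ← Matrix.mul_assoc Eᴴ, h1,
      Matrix.one_mul, ← Matrix.mul_assoc, hVd, hG, Matrix.mul_assoc, h2, Matrix.mul_one]

omit [DecidableEq X] [DecidableEq Z] in
theorem hsSq_mul_le (C : Matrix Z Y ℂ) (K : Matrix Y X ℂ) : hsSq (C * K) ≤ ‖C‖ ^ 2 * hsSq K := by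
  have h : ∀ {A : Type} [Fintype A] (N : Matrix A X ℂ),
      hsSq N = ∑ j, ‖(WithLp.toLp 2 (fun i => N i j) : EuclideanSpace ℂ A)‖ ^ 2 := by
    intro A _ N
    rw [hsSq, Finset.sum_comm]
    refine Finset.sum_congr rfl fun j _ => ?_
    rw [EuclideanSpace.norm_sq_eq]
  rw [h, h, Finset.mul_sum]
  refine Finset.sum_le_sum fun j _ => ?_
  rw [← mul_pow]
  refine pow_le_pow_left₀ (norm_nonneg _) ?_ 2
  exact l2_opNorm_mulVec C (WithLp.toLp 2 fun i => K i j)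

/-- Write `H = K²` with `K` positive and apply Cauchy-Schwarz to `Tr (K · C K)`. -/
theorem norm_trace_mul_posSemidef_le (C : Matrix X X ℂ) {H : Matrix X X ℂ} (hH : H.PosSemidef) :
    ‖(C * H).trace‖ ≤ ‖C‖ * H.trace.re := by
  have hK := psdSqrt_posSemidef hH
  have hKK := psdSqrt_mul_self hH
  set K := psdSqrt H
  have h1 : hsSq K = H.trace.re := by rw [hsSq_eq, hK.1, hKK]
  have h2 : (C * H).trace = (Kᴴ * (C * K)).trace := by
    rw [hK.1, ← hKK, ← Matrix.mul_assoc, Matrix.trace_mul_comm]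
  rw [h2]
  refine (norm_trace_conjTranspose_mul_le _ _).trans ?_
  have h3 : Real.sqrt (hsSq (C * K)) ≤ ‖C‖ * Real.sqrt (hsSq K) := by
    rw [← Real.sqrt_sq (norm_nonneg C), ← Real.sqrt_mul (sq_nonneg _)]
    exact Real.sqrt_le_sqrt (hsSq_mul_le C K)
  calc _ ≤ Real.sqrt (hsSq K) * (‖C‖ * Real.sqrt (hsSq K)) :=
        mul_le_mul_of_nonneg_left h3 (Real.sqrt_nonneg _)
    _ = ‖C‖ * (Real.sqrt (hsSq K) * Real.sqrt (hsSq K)) := by ring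
    _ = _ := by rw [Real.mul_self_sqrt (hsSq_nonneg K), h1]

/-- Hölder's inequality between operator norm and trace norm. The trace norm is written out since
`M` may be rectangular. -/
theorem norm_trace_mul_le (C : Matrix X Y ℂ) (M : Matrix Y X ℂ) :
    ‖(C * M).trace‖ ≤ ‖C‖ * (psdSqrt (Mᴴ * M)).trace.re := by
  have hp := psdSqrt_posSemidef (posSemidef_conjTranspose_mul_self M)
  obtain ⟨W, hW, h1, -⟩ := exists_contraction_polar M
  have : C * M = (C * W) * psdSqrt (Mᴴ * M) := by rw [Matrix.mul_assoc, ← h1]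
  rw [this]
  refine (norm_trace_mul_posSemidef_le _ hp).trans ?_
  refine mul_le_mul_of_nonneg_right ?_ (posSemidef_trace_re_nonneg hp)
  exact (l2_opNorm_mul C W).trans (mul_le_of_le_one_right (norm_nonneg _) hW)

end Polar

/-! ### The trace norm -/

section TraceNorm

open scoped Matrix.Norms.L2Operator

variable {X Y : Type} [Fintype X] [DecidableEq X] [Fintype Y] [DecidableEq Y]

theorem norm_trace_mul_le_traceNorm {C : Matrix X X ℂ} (hC : ‖C‖ ≤ 1) (M : Matrix X X ℂ) :
    ‖(C * M).trace‖ ≤ traceNorm M :=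
  (norm_trace_mul_le C M).trans (mul_le_of_le_one_left
    (posSemidef_trace_re_nonneg (psdSqrt_posSemidef (posSemidef_conjTranspose_mul_self M))) hC)

/-- The adjoint of the polar factor attains the Hölder bound. So the trace norm is a maximum of
linear functionals over contractions, whence the triangle inequality. -/
theorem exists_traceNorm_eq (M : Matrix X X ℂ) :
    ∃ C : Matrix X X ℂ, ‖C‖ ≤ 1 ∧ traceNorm M = (C * M).trace.re := by
  obtain ⟨W, hW, -, h⟩ := exists_contraction_polar M
  exact ⟨Wᴴ, by rwa [l2_opNorm_conjTranspose], by rw [h, traceNorm]⟩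

theorem traceNorm_nonneg (M : Matrix X X ℂ) : 0 ≤ traceNorm M :=
  posSemidef_trace_re_nonneg (psdSqrt_posSemidef (posSemidef_conjTranspose_mul_self M))

theorem traceNorm_add_le (M N : Matrix X X ℂ) :
    traceNorm (M + N) ≤ traceNorm M + traceNorm N := by
  obtain ⟨C, hC, h⟩ := exists_traceNorm_eq (M + N)
  rw [h, Matrix.mul_add, Matrix.trace_add, Complex.add_re]
  exact add_le_add ((Complex.re_le_norm _).trans (norm_trace_mul_le_traceNorm hC M))
    ((Complex.re_le_norm _).trans (norm_trace_mul_le_traceNorm hC N))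

theorem traceNorm_neg (M : Matrix X X ℂ) : traceNorm (-M) = traceNorm M := by
  simp [traceNorm]

theorem traceNorm_sub_le (M N : Matrix X X ℂ) :
    traceNorm (M - N) ≤ traceNorm M + traceNorm N := by
  rw [sub_eq_add_neg, ← traceNorm_neg N]
  exact traceNorm_add_le _ _

theorem traceNorm_smul {c : ℝ} (hc : 0 ≤ c) (M : Matrix X X ℂ) :
    traceNorm (c • M) = c * traceNorm M := by
  have : (c • M)ᴴ * (c • M) = (c ^ 2 : ℝ) • (Mᴴ * M) := by
    simp [smul_smul, sq]
  rw [traceNorm, this, psdSqrt_smul (posSemidef_conjTranspose_mul_self M) hc, Matrix.trace_smul,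
    Complex.smul_re, smul_eq_mul, traceNorm]

theorem traceNorm_of_posSemidef {M : Matrix X X ℂ} (hM : M.PosSemidef) :
    traceNorm M = M.trace.re := by
  rw [traceNorm, hM.1, psdSqrt_of_mul_self hM]

theorem norm_trace_le_traceNorm (M : Matrix X X ℂ) : ‖M.trace‖ ≤ traceNorm M := by
  have h1 : ‖(1 : Matrix X X ℂ)‖ ≤ 1 := norm_le_one_of_isIdempotentElem (by simp) (by simp)
  have := norm_trace_mul_le_traceNorm h1 M
  rwa [Matrix.one_mul] at this

omit [DecidableEq Y] in
theorem traceNorm_mul_conjTranspose_le (M N : Matrix X Y ℂ) :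
    traceNorm (M * Nᴴ) ≤ Real.sqrt (hsSq M) * Real.sqrt (hsSq N) := by
  obtain ⟨C, hC, h⟩ := exists_traceNorm_eq (M * Nᴴ)
  rw [h]
  refine (Complex.re_le_norm _).trans ?_
  rw [← Matrix.mul_assoc, Matrix.trace_mul_comm, mul_comm]
  refine (norm_trace_conjTranspose_mul_le _ _).trans ?_
  refine mul_le_mul_of_nonneg_left (Real.sqrt_le_sqrt ?_) (Real.sqrt_nonneg _)
  refine (hsSq_mul_le C M).trans (mul_le_of_le_one_left (hsSq_nonneg M) ?_)
  exact pow_le_one₀ (norm_nonneg _) hC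

theorem hsSq_one : hsSq (1 : Matrix X X ℂ) = Fintype.card X := by
  rw [hsSq_eq, conjTranspose_one, Matrix.one_mul, Matrix.trace_one]
  simp

/-- Cauchy-Schwarz against the identity; this is where the dimension `L d_R` enters the error bound.
-/
theorem traceNorm_le_sqrt_card_mul (M : Matrix X X ℂ) :
    traceNorm M ≤ Real.sqrt (Fintype.card X) * Real.sqrt (hsSq M) := by
  have := traceNorm_mul_conjTranspose_le M (1 : Matrix X X ℂ)
  rwa [conjTranspose_one, Matrix.mul_one, hsSq_one, mul_comm] at this

end TraceNorm

/-! ### Continuity of the trace norm, needed for Haar integrability. -/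

section Continuity

variable {X Y : Type} [Fintype X] [DecidableEq X] [Fintype Y]

omit [DecidableEq X] in
theorem continuous_hsSq : Continuous (hsSq : Matrix X Y ℂ → ℝ) := by
  unfold hsSq
  fun_prop

omit [DecidableEq X] in
theorem hsSq_zero : hsSq (0 : Matrix X Y ℂ) = 0 := by
  simp [hsSq]

theorem continuous_traceNorm : Continuous (traceNorm : Matrix X X ℂ → ℝ) := by
  rw [continuous_iff_continuousAt]
  intro M
  have h : Filter.Tendsto (fun N : Matrix X X ℂ =>
      Real.sqrt (Fintype.card X) * Real.sqrt (hsSq (N - M))) (nhds M) (nhds 0) := by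
    have hc : Continuous fun N : Matrix X X ℂ =>
        Real.sqrt (Fintype.card X) * Real.sqrt (hsSq (N - M)) :=
      continuous_const.mul
        (Real.continuous_sqrt.comp (continuous_hsSq.comp (continuous_id.sub continuous_const)))
    have := hc.tendsto M
    simpa [hsSq_zero] using this
  refine tendsto_iff_dist_tendsto_zero.mpr (squeeze_zero (fun _ => dist_nonneg) (fun N => ?_) h)
  refine le_trans ?_ (traceNorm_le_sqrt_card_mul (N - M))
  rw [Real.dist_eq, abs_sub_le_iff]
  constructor
  · have := traceNorm_add_le (N - M) M
    rw [sub_add_cancel] at this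
    linarith
  · have := traceNorm_add_le (M - N) N
    rw [sub_add_cancel, ← traceNorm_neg (M - N), neg_sub] at this
    linarith

end Continuity

/-! ### Fidelity and trace distance -/

section HilbertSchmidtExpansion

variable {X Y : Type} [Fintype X] [Fintype Y]

theorem trace_conjTranspose_mul_comm_re (M N : Matrix X Y ℂ) :
    (Nᴴ * M).trace.re = (Mᴴ * N).trace.re := by
  rw [← Complex.conj_re, ← Complex.star_def, ← Matrix.trace_conjTranspose, conjTranspose_mul,
    conjTranspose_conjTranspose]

theorem hsSq_add (M N : Matrix X Y ℂ) :
    hsSq (M + N) = hsSq M + hsSq N + 2 * (Mᴴ * N).trace.re := by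
  rw [hsSq_eq, hsSq_eq, hsSq_eq, conjTranspose_add, Matrix.add_mul, Matrix.mul_add, Matrix.mul_add]
  simp only [Matrix.trace_add, Complex.add_re]
  rw [trace_conjTranspose_mul_comm_re M N]
  ring

theorem hsSq_sub (M N : Matrix X Y ℂ) :
    hsSq (M - N) = hsSq M + hsSq N - 2 * (Mᴴ * N).trace.re := by
  rw [hsSq_eq, hsSq_eq, hsSq_eq, conjTranspose_sub, Matrix.sub_mul, Matrix.mul_sub, Matrix.mul_sub]
  simp only [Matrix.trace_sub, Complex.sub_re]
  rw [trace_conjTranspose_mul_comm_re M N]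
  ring

end HilbertSchmidtExpansion

section PureState

variable {X : Type} [Fintype X]

theorem ketbra_mul_vecMulVec (v w : X → ℂ) :
    ketbra v * ketbra w = (star v ⬝ᵥ w) • vecMulVec v (star w) := by
  rw [ketbra, ketbra, vecMulVec_mul_vecMulVec, vecMulVec_smul]

theorem trace_ketbra (v : X → ℂ) : (ketbra v).trace = star v ⬝ᵥ v := by
  rw [ketbra, trace_vecMulVec, dotProduct_comm]

theorem star_dotProduct_self (v : X → ℂ) : star v ⬝ᵥ v = ((∑ i, ‖v i‖ ^ 2 : ℝ) : ℂ) := by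
  push_cast
  refine Finset.sum_congr rfl fun i _ => ?_
  rw [← Complex.conj_mul']
  rfl

theorem posSemidef_ketbra (v : X → ℂ) : (ketbra v).PosSemidef := posSemidef_vecMulVec_self_star v

theorem conj_ketbra {Y : Type} [Fintype Y] (S : Matrix Y X ℂ) (v : X → ℂ) :
    S * ketbra v * Sᴴ = ketbra (S *ᵥ v) := by
  rw [ketbra, mul_vecMulVec, vecMulVec_mul, ketbra, star_mulVec]

theorem star_dotProduct_mulVec_conjTranspose_mul {Y : Type} [Fintype Y] (S : Matrix Y X ℂ)
    (v : X → ℂ) : star (S *ᵥ v) ⬝ᵥ (S *ᵥ v) = star v ⬝ᵥ ((Sᴴ * S) *ᵥ v) := by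
  rw [star_mulVec, ← dotProduct_mulVec, mulVec_mulVec]

variable [DecidableEq X]

theorem trace_psdSqrt_ketbra (v : X → ℂ) :
    (psdSqrt (ketbra v)).trace.re = Real.sqrt (star v ⬝ᵥ v).re := by
  set q : ℝ := ∑ i, ‖v i‖ ^ 2 with hq
  have hq0 : 0 ≤ q := Finset.sum_nonneg fun _ _ => sq_nonneg _
  have hv : star v ⬝ᵥ v = (q : ℂ) := star_dotProduct_self v
  set r := Real.sqrt q with hr
  have hrr : r * r = q := Real.mul_self_sqrt hq0
  have hK : ((r⁻¹ : ℝ) • ketbra v).PosSemidef :=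
    (posSemidef_ketbra v).smul (inv_nonneg.mpr (Real.sqrt_nonneg _))
  have hKK : (r⁻¹ : ℝ) • ketbra v * (r⁻¹ : ℝ) • ketbra v = ketbra v := by
    rw [Matrix.smul_mul, Matrix.mul_smul, ketbra_mul_vecMulVec, hv, smul_smul]
    -- If `v = 0` then `r⁻¹ = 0` by convention, and the candidate root is 0 as required.
    rcases (Real.sqrt_nonneg q).eq_or_lt with h0 | h0
    · have hv0 : v = 0 := by
        rw [← dotProduct_star_self_eq_zero, hv, ← hrr, hr, ← h0]
        simp
      simp [hv0, ketbra]
    · have h1 : r ≠ 0 := h0.ne'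
      have : (r⁻¹ * r⁻¹) • ((q : ℂ) • vecMulVec v (star v)) = vecMulVec v (star v) := by
        rw [← hrr]
        ext i j
        simp only [Matrix.smul_apply, Complex.real_smul, smul_eq_mul]
        push_cast
        have : (r : ℂ) ≠ 0 := by exact_mod_cast h1
        field_simp
      exact this
  rw [psdSqrt_eq hK hKK, Matrix.trace_smul, trace_ketbra, hv, Complex.smul_re, Complex.ofReal_re,
    smul_eq_mul]
  rcases eq_or_ne r 0 with h0 | h0
  · simp [h0, ← hr]
  · rw [← hrr, inv_mul_cancel_left₀ h0, Real.sqrt_mul_self (Real.sqrt_nonneg _)]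

/-- The fidelity with a pure state is an expectation value. -/
theorem fidelity_ketbra {ρ : Matrix X X ℂ} (hρ : ρ.PosSemidef) (t : X → ℂ) :
    fidelity ρ (ketbra t) = (star t ⬝ᵥ (ρ *ᵥ t)).re := by
  have hS := (psdSqrt_posSemidef hρ).1
  have h : psdSqrt ρ * ketbra t * psdSqrt ρ = ketbra (psdSqrt ρ *ᵥ t) := by
    conv_lhs => rw [← hS.eq]
    rw [hS.eq, ← conj_ketbra, hS.eq]
  have h2 : star (psdSqrt ρ *ᵥ t) ⬝ᵥ (psdSqrt ρ *ᵥ t) = star t ⬝ᵥ (ρ *ᵥ t) := by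
    rw [star_dotProduct_mulVec_conjTranspose_mul, hS.eq, psdSqrt_mul_self hρ]
  rw [fidelity, h, trace_psdSqrt_ketbra, Real.sq_sqrt, h2]
  rw [star_dotProduct_self, Complex.ofReal_re]
  exact Finset.sum_nonneg fun _ _ => sq_nonneg _

/-- `N Nᴴ - T Tᴴ` is the symmetrised product of `N - T` and `N + T`, whose squared Hilbert-Schmidt
norms are `2 (1 - r)` and `2 (1 + r)`. Read as purifications, unit matrices bound the distance of
the states by their overlap. -/
theorem traceNorm_mul_sub_mul_le {Y : Type} [Fintype Y] {N T : Matrix X Y ℂ} (hN : hsSq N = 1)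
    (hT : hsSq T = 1) :
    traceNorm (N * Nᴴ - T * Tᴴ) ≤ 2 * Real.sqrt (1 - (Nᴴ * T).trace.re ^ 2) := by
  set r := (Nᴴ * T).trace.re with hr
  have hsub : hsSq (N - T) = 2 * (1 - r) := by rw [hsSq_sub, hN, hT]; ring
  have hadd : hsSq (N + T) = 2 * (1 + r) := by rw [hsSq_add, hN, hT]; ring
  have hid : N * Nᴴ - T * Tᴴ =
      (1 / 2 : ℝ) • ((N - T) * (N + T)ᴴ + (N + T) * (N - T)ᴴ) := by
    rw [conjTranspose_add, conjTranspose_sub]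
    simp only [Matrix.mul_add, Matrix.add_mul, Matrix.mul_sub, Matrix.sub_mul]
    module
  have h1 := traceNorm_mul_conjTranspose_le (N - T) (N + T)
  have h2 := traceNorm_mul_conjTranspose_le (N + T) (N - T)
  have h3 := traceNorm_add_le ((N - T) * (N + T)ᴴ) ((N + T) * (N - T)ᴴ)
  have h4 : Real.sqrt (hsSq (N - T)) * Real.sqrt (hsSq (N + T)) = 2 * Real.sqrt (1 - r ^ 2) := by
    rw [← Real.sqrt_mul (hsSq_nonneg _), hsub, hadd]
    have : 2 * (1 - r) * (2 * (1 + r)) = 2 ^ 2 * (1 - r ^ 2) := by ring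
    rw [this, Real.sqrt_mul (by norm_num), Real.sqrt_sq (by norm_num)]
  rw [hid, traceNorm_smul (by norm_num)]
  linarith [mul_comm (Real.sqrt (hsSq (N - T))) (Real.sqrt (hsSq (N + T)))]

/-- The Fuchs-van de Graaf bound on the trace distance to a pure state. -/
theorem traceNorm_sub_ketbra_le {ρ : Matrix X X ℂ} (hρ : ρ.PosSemidef) (htr : ρ.trace.re = 1)
    {t : X → ℂ} (ht : IsStateVector t) :
    traceNorm (ρ - ketbra t) ≤ 2 * Real.sqrt (1 - (star t ⬝ᵥ (ρ *ᵥ t)).re) := by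
  have hS := (psdSqrt_posSemidef hρ).1
  have hSS := psdSqrt_mul_self hρ
  set N := psdSqrt ρ
  set w := N *ᵥ t with hw
  set q : ℝ := ∑ i, ‖w i‖ ^ 2 with hq
  have hq0 : 0 ≤ q := Finset.sum_nonneg fun _ _ => sq_nonneg _
  have hwq : star w ⬝ᵥ w = (q : ℂ) := star_dotProduct_self w
  have hqt : (star t ⬝ᵥ (ρ *ᵥ t)).re = q := by
    have := star_dotProduct_mulVec_conjTranspose_mul N t
    rw [hS.eq, hSS, ← hw, hwq] at this
    rw [← this, Complex.ofReal_re]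
  -- The matrix `|t⟩⟨x|` purifies `|t⟩⟨t|` for every unit `x`. The overlap with the purification
  -- `√ρ` of `ρ` is largest for `x` proportional to `√ρ t`; if that vector is 0 any unit vector
  -- serves.
  obtain ⟨x, hx, hxw⟩ : ∃ x : X → ℂ, IsStateVector x ∧ (star x ⬝ᵥ w).re = Real.sqrt q := by
    rcases hq0.eq_or_lt with h0 | h0
    · have hw0 : w = 0 := by
        rw [← dotProduct_star_self_eq_zero, hwq, ← h0]
        simp
      exact ⟨t, ht, by simp [hw0, ← h0]⟩
    · have hr := Real.sqrt_pos.mpr h0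
      have hrr := Real.mul_self_sqrt hq0
      have hr' : (Real.sqrt q : ℂ) ≠ 0 := by exact_mod_cast hr.ne'
      refine ⟨((Real.sqrt q)⁻¹ : ℂ) • w, ?_, ?_⟩
      · rw [IsStateVector, star_smul, smul_dotProduct, dotProduct_smul, hwq]
        simp only [smul_eq_mul, star_inv₀, RCLike.star_def, Complex.conj_ofReal]
        have : (q : ℂ) = Real.sqrt q * Real.sqrt q := by exact_mod_cast hrr.symm
        rw [this]
        field_simp
      · rw [star_smul, smul_dotProduct, hwq]
        simp only [smul_eq_mul, star_inv₀, RCLike.star_def, Complex.conj_ofReal]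
        rw [← Complex.ofReal_inv, ← Complex.ofReal_mul, Complex.ofReal_re]
        conv_lhs => rw [← hrr]
        rw [Real.sqrt_mul_self hr.le, inv_mul_cancel_left₀ hr.ne']
  set T : Matrix X X ℂ := vecMulVec t (star x) with hT
  have hTT : T * Tᴴ = ketbra t := by
    rw [hT, conjTranspose_vecMulVec, star_star, vecMulVec_mul_vecMulVec, hx, one_smul, ketbra]
  have hN1 : hsSq N = 1 := by rw [hsSq_eq, hS.eq, hSS, htr]
  have hT1 : hsSq T = 1 := by
    rw [hsSq_eq, Matrix.trace_mul_comm, hTT, trace_ketbra, ht, Complex.one_re]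
  have hNT : (Nᴴ * T).trace.re = Real.sqrt q := by
    rw [hS.eq, hT, mul_vecMulVec, trace_vecMulVec, dotProduct_comm, ← hw, hxw]
  have := traceNorm_mul_sub_mul_le hN1 hT1
  rwa [hNT, Real.sq_sqrt hq0, hTT, hS.eq, hSS, ← hqt] at this

end PureState

/-! ### The Powers-Størmer inequality and Uhlmann's theorem. -/

section PowersStormer

open scoped Matrix.Norms.L2Operator

variable {X Y Z : Type} [Fintype X] [DecidableEq X]

theorem trace_conj_diagonal_mul (E P : Matrix X X ℂ) (l : X → ℝ) :
    (E * diagonal (fun i => (l i : ℂ)) * Eᴴ * P).trace.re =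
      ∑ i, l i * ((Eᴴ * P * E) i i).re := by
  have : (E * diagonal (fun i => (l i : ℂ)) * Eᴴ * P).trace =
      (diagonal (fun i => (l i : ℂ)) * (Eᴴ * P * E)).trace := by
    rw [Matrix.mul_assoc, Matrix.mul_assoc, Matrix.trace_mul_comm]
    simp only [Matrix.mul_assoc]
  rw [this, Matrix.trace, Complex.re_sum]
  refine Finset.sum_congr rfl fun i _ => ?_
  rw [diag_apply, diagonal_mul, Complex.re_ofReal_mul]

/-- The Powers-Størmer inequality. -/
theorem hsSq_sub_le_traceNorm {A B : Matrix X X ℂ} (hA : A.PosSemidef) (hB : B.PosSemidef) :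
    hsSq (A - B) ≤ traceNorm (A * A - B * B) := by
  have hK : (A - B).IsHermitian := hA.1.sub hB.1
  obtain ⟨E, l, h1, h2, h3, -⟩ := exists_spectral_cfc hK
  -- `S` is the sign and `T` the absolute value of `A - B`. Testing `A² - B²` against the
  -- contraction `S` gives `Tr |A - B| (A + B)`.
  set S : Matrix X X ℂ := E * diagonal (fun i => ((SignType.sign (l i) : ℝ) : ℂ)) * Eᴴ with hS
  set T : Matrix X X ℂ := E * diagonal (fun i => ((|l i| : ℝ) : ℂ)) * Eᴴ with hT
  have hSn : ‖S‖ ≤ 1 := by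
    have hs : Sᴴ = S := conj_diagonal_conjTranspose _ _
    have hid : ‖Sᴴ * S‖ ≤ 1 := by
      refine norm_le_one_of_isIdempotentElem ?_ ?_
      · rw [conjTranspose_mul, conjTranspose_conjTranspose]
      · rw [hs, hS, conj_diagonal_mul h1, conj_diagonal_mul h1]
        congr 3
        ext i
        rcases lt_trichotomy (l i) 0 with h | h | h <;> simp [h]
    rw [l2_opNorm_conjTranspose_mul_self] at hid
    by_contra! hc
    nlinarith
  have hSK : S * (A - B) = T := by
    rw [h3, hS, conj_diagonal_mul h1]
    congr 3
    ext i
    rw [← Complex.ofReal_mul, sign_mul_self]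
  have hKS : (A - B) * S = T := by
    rw [h3, hS, conj_diagonal_mul h1]
    congr 3
    ext i
    rw [← Complex.ofReal_mul, self_mul_sign]
  have hid : A * A - B * B = (1 / 2 : ℝ) • ((A - B) * (A + B) + (A + B) * (A - B)) := by
    simp only [Matrix.mul_add, Matrix.add_mul, Matrix.mul_sub, Matrix.sub_mul]
    module
  have htr : (S * (A * A - B * B)).trace = (T * (A + B)).trace := by
    rw [hid, Matrix.mul_smul, Matrix.trace_smul, Matrix.mul_add, Matrix.trace_add,
      ← Matrix.mul_assoc, hSK, Matrix.trace_mul_comm S, Matrix.mul_assoc (A + B), hKS,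
      Matrix.trace_mul_comm (A + B)]
    module
  have hle := (Complex.re_le_norm _).trans (norm_trace_mul_le_traceNorm hSn (A * A - B * B))
  rw [htr, hT, trace_conj_diagonal_mul] at hle
  refine le_trans ?_ hle
  rw [hsSq_eq, hK.eq]
  nth_rewrite 1 [h3]
  rw [trace_conj_diagonal_mul]
  -- In the eigenbasis of `A - B`, the claim reduces to `l (a - b) ≤ |l| (a + b)` for diagonal
  -- entries `a, b ≥ 0` of `A` and `B`.
  refine Finset.sum_le_sum fun i _ => ?_
  have ha := (hA.conjTranspose_mul_mul_same E).diag_nonneg (i := i)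
  have hb := (hB.conjTranspose_mul_mul_same E).diag_nonneg (i := i)
  have ha' := (Complex.le_def.mp ha).1
  have hb' := (Complex.le_def.mp hb).1
  rw [Matrix.mul_sub, Matrix.sub_mul, Matrix.mul_add, Matrix.add_mul, Matrix.sub_apply,
    Matrix.add_apply, Complex.sub_re, Complex.add_re]
  simp only [Complex.zero_re] at ha' hb'
  rcases abs_cases (l i) with ⟨h, h0⟩ | ⟨h, h0⟩ <;> rw [h] <;> nlinarith

/-- For states, `‖√ρ - √σ‖₂² = 2 - 2 Tr √ρ √σ`, to which Powers-Størmer applies. -/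
theorem one_sub_traceNorm_le_trace_sqrt_mul_sqrt {ρ σ : Matrix X X ℂ} (hρ : ρ.PosSemidef)
    (hσ : σ.PosSemidef) (hρ1 : ρ.trace.re = 1) (hσ1 : σ.trace.re = 1) :
    1 - traceNorm (ρ - σ) / 2 ≤ (psdSqrt ρ * psdSqrt σ).trace.re := by
  have hA := psdSqrt_posSemidef hρ
  have hB := psdSqrt_posSemidef hσ
  have h := hsSq_sub_le_traceNorm hA hB
  rw [psdSqrt_mul_self hρ, psdSqrt_mul_self hσ, hsSq_sub, hsSq_eq, hsSq_eq, hA.1.eq, hB.1.eq,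
    psdSqrt_mul_self hρ, psdSqrt_mul_self hσ, hρ1, hσ1] at h
  linarith

variable [Fintype Y] [DecidableEq Y] [Fintype Z] [DecidableEq Z]

/-- Uhlmann's theorem: purifications of two states overlap, after an isometry on the purifying
system, at least as much as the square roots of the states. -/
theorem exists_isometry_trace_sqrt_mul_sqrt_le (hYZ : Fintype.card Y ≤ Fintype.card Z)
    (M : Matrix X Y ℂ) (T : Matrix X Z ℂ) :
    ∃ V : Matrix Z Y ℂ, Vᴴ * V = 1 ∧
      (psdSqrt (M * Mᴴ) * psdSqrt (T * Tᴴ)).trace.re ≤ (Vᴴ * (Tᴴ * M)).trace.re := by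
  -- With this `V` the overlap equals `Tr |Tᴴ M|`. The contractions `W₁`, `W₂` write the two roots
  -- through `M` and `T`, so Hölder bounds the trace of their product by the same quantity.
  obtain ⟨V, hV, hVM⟩ := exists_isometry_polar hYZ (Tᴴ * M)
  obtain ⟨W₁, hW₁, -, h₁⟩ := exists_contraction_polar Mᴴ
  obtain ⟨W₂, hW₂, -, h₂⟩ := exists_contraction_polar Tᴴ
  rw [conjTranspose_conjTranspose] at h₁ h₂
  refine ⟨V, hV, ?_⟩
  have hs : psdSqrt (M * Mᴴ) = M * W₁ := by
    have := (psdSqrt_posSemidef (posSemidef_self_mul_conjTranspose M)).1.eq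
    rw [← this, ← h₁, conjTranspose_mul, conjTranspose_conjTranspose, conjTranspose_conjTranspose]
  have htr : (psdSqrt (M * Mᴴ) * psdSqrt (T * Tᴴ)).trace = (W₁ * W₂ᴴ * (Tᴴ * M)).trace := by
    rw [hs, ← h₂, Matrix.mul_assoc, Matrix.trace_mul_comm]
    simp only [Matrix.mul_assoc]
  have hval : Vᴴ * (Tᴴ * M) = psdSqrt ((Tᴴ * M)ᴴ * (Tᴴ * M)) := by
    conv_lhs => rw [hVM]
    rw [← Matrix.mul_assoc, hV, Matrix.one_mul]
  rw [htr, hval]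
  refine (Complex.re_le_norm _).trans ((norm_trace_mul_le _ _).trans ?_)
  refine mul_le_of_le_one_left
    (posSemidef_trace_re_nonneg (psdSqrt_posSemidef (posSemidef_conjTranspose_mul_self _))) ?_
  refine (l2_opNorm_mul _ _).trans ?_
  rw [l2_opNorm_conjTranspose]
  exact mul_le_one₀ hW₁ (norm_nonneg _) hW₂

end PowersStormer

/-! ### Second moments of randomly rotated projections -/

section HaarMoments

theorem trace_eq_rank_of_isIdempotentElem {A : Type} [Fintype A] [DecidableEq A]
    {P : Matrix A A ℂ} (hP : P * P = P) : P.trace = P.rank := by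
  have h : IsIdempotentElem (Matrix.toLin' P) := by
    rw [IsIdempotentElem, Module.End.mul_eq_comp, ← Matrix.toLin'_mul, hP]
  have := (LinearMap.IsIdempotentElem.isProj_range _ h).trace
  rwa [Matrix.trace_toLin'_eq] at this

variable (A : Type) [Fintype A] [DecidableEq A]

instance : IsProbabilityMeasure (unitaryHaar A) := ⟨Measure.haarMeasure_self⟩

instance : (unitaryHaar A).IsHaarMeasure := by
  unfold unitaryHaar
  infer_instance

/-- A right translate of Haar measure is again a left-invariant probability measure, hence the same
one by uniqueness. -/
instance : (unitaryHaar A).IsMulRightInvariant := by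
  refine ⟨fun g => ?_⟩
  have : IsProbabilityMeasure (Measure.map (· * g) (unitaryHaar A)) :=
    Measure.isProbabilityMeasure_map (by fun_prop)
  exact Measure.isHaarMeasure_eq_of_isProbabilityMeasure _ _

variable {A}

theorem integrable_unitaryHaar {E : Type} [NormedAddCommGroup E] {f : unitaryGroup A ℂ → E}
    (hf : Continuous f) : Integrable f (unitaryHaar A) :=
  hf.integrable_of_hasCompactSupport (HasCompactSupport.of_compactSpace f)

/-- The rotated operator `Uᴴ G U`. -/
def rotated (G : Matrix A A ℂ) (U : unitaryGroup A ℂ) : Matrix A A ℂ :=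
  (U : Matrix A A ℂ)ᴴ * G * U

theorem continuous_rotated (G : Matrix A A ℂ) : Continuous (rotated G) := by
  unfold rotated
  fun_prop

theorem continuous_rotated_apply (G : Matrix A A ℂ) (a b : A) :
    Continuous fun U => rotated G U a b := by
  unfold rotated
  fun_prop

theorem coe_mul_conjTranspose (U : unitaryGroup A ℂ) :
    (U : Matrix A A ℂ) * (U : Matrix A A ℂ)ᴴ = 1 :=
  Unitary.coe_mul_star_self U

theorem conjTranspose_mul_coe (U : unitaryGroup A ℂ) :
    (U : Matrix A A ℂ)ᴴ * (U : Matrix A A ℂ) = 1 :=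
  Unitary.coe_star_mul_self U

theorem trace_rotated (G : Matrix A A ℂ) (U : unitaryGroup A ℂ) :
    (rotated G U).trace = G.trace := by
  rw [rotated, Matrix.mul_assoc, Matrix.trace_mul_comm, Matrix.mul_assoc, coe_mul_conjTranspose,
    Matrix.mul_one]

theorem rotated_mul_self {G : Matrix A A ℂ} (hG : G * G = G) (U : unitaryGroup A ℂ) :
    rotated G U * rotated G U = rotated G U := by
  rw [rotated]
  calc (U : Matrix A A ℂ)ᴴ * G * U * ((U : Matrix A A ℂ)ᴴ * G * U)
      = (U : Matrix A A ℂ)ᴴ * G * ((U : Matrix A A ℂ) * (U : Matrix A A ℂ)ᴴ) * G * U := by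
        simp only [Matrix.mul_assoc]
    _ = _ := by rw [coe_mul_conjTranspose, Matrix.mul_one, Matrix.mul_assoc _ G G, hG]

/-- Right invariance under `U ↦ U V`. All moment identities below come from special choices of `V`:
phases, permutations and one two-dimensional rotation. -/
theorem integral_rotated {E : Type} [NormedAddCommGroup E] [NormedSpace ℝ E]
    (G : Matrix A A ℂ) (f : Matrix A A ℂ → E) {V : Matrix A A ℂ} (hV : V ∈ unitaryGroup A ℂ) :
    ∫ U, f (rotated G U) ∂(unitaryHaar A) = ∫ U, f (Vᴴ * rotated G U * V) ∂(unitaryHaar A) := by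
  rw [← integral_mul_right_eq_self (μ := unitaryHaar A) (fun U => f (rotated G U)) ⟨V, hV⟩]
  refine integral_congr_ae (Filter.Eventually.of_forall fun U => ?_)
  simp [rotated, conjTranspose_mul, Matrix.mul_assoc]

/-- The second moment `𝔼 G_ab G_cd` of the entries of the randomly rotated operator. -/
def rotatedMoment (G : Matrix A A ℂ) (a b c d : A) : ℂ :=
  ∫ U, rotated G U a b * rotated G U c d ∂(unitaryHaar A)

theorem diagonal_mem_unitaryGroup {z : A → ℂ} (hz : ∀ a, star (z a) * z a = 1) :
    diagonal z ∈ unitaryGroup A ℂ := by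
  rw [mem_unitaryGroup_iff', star_eq_conjTranspose, diagonal_conjTranspose, diagonal_mul_diagonal,
    ← diagonal_one]
  congr 1
  ext a
  exact hz a

/-- The unitary multiplying the basis vector `x` by `i` and fixing the others. -/
theorem phase_mem_unitaryGroup (x : A) :
    diagonal (fun a => if a = x then Complex.I else 1) ∈ unitaryGroup A ℂ := by
  refine diagonal_mem_unitaryGroup fun a => ?_
  split_ifs <;> simp

theorem phase_conj_apply (M : Matrix A A ℂ) (x a b : A) :
    ((diagonal (fun a => if a = x then Complex.I else 1))ᴴ * M *
      diagonal (fun a => if a = x then Complex.I else 1)) a b =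
      (if a = x then -Complex.I else 1) * M a b * (if b = x then Complex.I else 1) := by
  rw [mul_diagonal, diagonal_conjTranspose, diagonal_mul]
  congr 2
  simp only [Pi.star_apply]
  split_ifs <;> simp

theorem rotatedMoment_phase (G : Matrix A A ℂ) (x a b c d : A) :
    rotatedMoment G a b c d =
      ((if a = x then -Complex.I else 1) * (if b = x then Complex.I else 1) *
        (if c = x then -Complex.I else 1) * (if d = x then Complex.I else 1)) *
      rotatedMoment G a b c d := by
  conv_lhs => rw [rotatedMoment, integral_rotated G (fun M => M a b * M c d)
    (phase_mem_unitaryGroup x)]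
  rw [rotatedMoment, ← integral_const_mul]
  refine integral_congr_ae (Filter.Eventually.of_forall fun U => ?_)
  simp only [phase_conj_apply]
  ring

theorem eq_zero_of_eq_mul {z w : ℂ} (h : z = w * z) (hw : w ≠ 1) : z = 0 := by
  have h' : (1 - w) * z = 0 := by linear_combination h
  exact (mul_eq_zero.mp h').resolve_left (sub_ne_zero.mpr hw.symm)

/-- Unless the indices pair up, some basis vector has a phase that does not cancel. The phase is `i`
and not `-1` because when `a = c` is unmatched it appears squared, and only `i` then leaves a factor
other than 1. -/
theorem rotatedMoment_eq_zero (G : Matrix A A ℂ) {a b c d : A} (h1 : ¬ (a = b ∧ c = d))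
    (h2 : ¬ (a = d ∧ c = b)) : rotatedMoment G a b c d = 0 := by
  have hI : (-Complex.I) ≠ 1 := fun h => by simpa using congrArg Complex.re h
  have hm : (-1 : ℂ) ≠ 1 := by norm_num
  by_cases hab : a = b
  · subst hab
    have hcd : d ≠ c := fun h => h1 ⟨rfl, h.symm⟩
    refine eq_zero_of_eq_mul (rotatedMoment_phase G c a a c d) ?_
    split_ifs <;> simp_all
  · by_cases had : a = d
    · subst had
      have hcb : b ≠ c := fun h => h2 ⟨rfl, h.symm⟩
      refine eq_zero_of_eq_mul (rotatedMoment_phase G c a b c a) ?_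
      split_ifs <;> simp_all
    · refine eq_zero_of_eq_mul (rotatedMoment_phase G a a b c d) ?_
      have hba : b ≠ a := fun h => hab h.symm
      have hda : d ≠ a := fun h => had h.symm
      split_ifs <;> simp_all

theorem one_submatrix_mem_unitaryGroup (σ : Equiv.Perm A) :
    (1 : Matrix A A ℂ).submatrix id σ ∈ unitaryGroup A ℂ := by
  rw [mem_unitaryGroup_iff', star_eq_conjTranspose, conjTranspose_submatrix, conjTranspose_one,
    ← submatrix_mul _ _ _ _ _ Function.bijective_id, Matrix.mul_one, submatrix_one_equiv]

theorem one_submatrix_conj_apply (σ : Equiv.Perm A) (M : Matrix A A ℂ) (a b : A) :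
    (((1 : Matrix A A ℂ).submatrix id σ)ᴴ * M * (1 : Matrix A A ℂ).submatrix id σ) a b =
      M (σ a) (σ b) := by
  simp [Matrix.mul_apply, Matrix.one_apply, eq_comm]

theorem rotatedMoment_perm (G : Matrix A A ℂ) (σ : Equiv.Perm A) (a b c d : A) :
    rotatedMoment G a b c d = rotatedMoment G (σ a) (σ b) (σ c) (σ d) := by
  rw [rotatedMoment, integral_rotated G (fun M => M a b * M c d)
    (one_submatrix_mem_unitaryGroup σ)]
  simp only [one_submatrix_conj_apply]
  rfl

omit [Fintype A] in
theorem exists_perm_map_pair {x y a b : A} (hxy : x ≠ y) (hab : a ≠ b) :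
    ∃ σ : Equiv.Perm A, σ x = a ∧ σ y = b := by
  refine ⟨(Equiv.swap x a).trans (Equiv.swap (Equiv.swap x a y) b), ?_, ?_⟩
  · rw [Equiv.trans_apply, Equiv.swap_apply_left]
    refine Equiv.swap_apply_of_ne_of_ne (fun h => hxy ?_) hab
    apply (Equiv.swap x a).injective
    rw [Equiv.swap_apply_left, ← h]
  · rw [Equiv.trans_apply, Equiv.swap_apply_left]

/-- The unitary `1 - (1 - i) P` for the projection `P` onto the span of `e_x + e_y`. -/
def pairRotation (x y : A) : Matrix A A ℂ :=
  1 - ((1 - Complex.I) / 2) • ketbra (Pi.single x 1 + Pi.single y 1 : A → ℂ)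

theorem pairRotation_mem_unitaryGroup {x y : A} (hxy : x ≠ y) :
    pairRotation x y ∈ unitaryGroup A ℂ := by
  set v : A → ℂ := Pi.single x 1 + Pi.single y 1 with hv
  have hvv : star v ⬝ᵥ v = 2 := by
    have h : star v = v := by
      ext i
      simp only [hv, Pi.star_apply, Pi.add_apply, Pi.single_apply]
      split_ifs <;> simp
    rw [h, hv, add_dotProduct, single_dotProduct, single_dotProduct]
    simp [hxy, hxy.symm]
    norm_num
  have hk : ketbra v * ketbra v = (2 : ℂ) • ketbra v := by rw [ketbra_mul_vecMulVec, hvv, ketbra]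
  have hs : (pairRotation x y)ᴴ = 1 - ((1 + Complex.I) / 2) • ketbra v := by
    rw [pairRotation, conjTranspose_sub, conjTranspose_smul, conjTranspose_one,
      (posSemidef_ketbra _).1.eq]
    simp [hv, sub_eq_add_neg]
  rw [mem_unitaryGroup_iff', star_eq_conjTranspose, hs, pairRotation, ← hv, Matrix.sub_mul,
    Matrix.mul_sub, Matrix.mul_sub, Matrix.mul_one, Matrix.one_mul,
    Matrix.mul_one, Matrix.smul_mul, Matrix.mul_smul, hk, smul_smul, smul_smul]
  have : (1 + Complex.I) / 2 * ((1 - Complex.I) / 2) * 2 = 1 := by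
    linear_combination (-1 / 2 : ℂ) * Complex.I_mul_I
  rw [this]
  module

theorem pairRotation_conj_apply {x y : A} (hxy : x ≠ y) (M : Matrix A A ℂ) :
    ((pairRotation x y)ᴴ * M * pairRotation x y) x x =
      (M x x + M y y + Complex.I * M x y - Complex.I * M y x) / 2 := by
  have hcol : ∀ i, pairRotation x y i x =
      (if i = x then (1 + Complex.I) / 2 else 0) - (if i = y then (1 - Complex.I) / 2 else 0) := by
    intro i
    simp only [pairRotation, Matrix.sub_apply, Matrix.one_apply, Matrix.smul_apply, ketbra,
      vecMulVec_apply, Pi.add_apply, Pi.single_apply, Pi.star_apply, smul_eq_mul, if_true,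
      if_neg hxy, add_zero, star_one, mul_one]
    by_cases h1 : i = x
    · subst h1
      simp [hxy]
      ring
    · by_cases h2 : i = y
      · subst h2
        simp [h1]
      · simp [h1, h2]
  rw [Matrix.mul_apply]
  simp only [Matrix.mul_apply, conjTranspose_apply, hcol, star_sub, apply_ite star, star_zero,
    mul_sub, sub_mul, Finset.sum_sub_distrib, mul_ite, ite_mul, mul_zero, zero_mul,
    Finset.sum_ite_eq', Finset.mem_univ, if_true]
  simp only [RCLike.star_def, map_div₀, map_add, map_sub, map_one, Complex.conj_I, map_ofNat]
  linear_combination ((-1 / 4 : ℂ) * (M x x + M y y) - (1 / 4 : ℂ) * (M x y + M y x)) * Complex.I_sq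

theorem integrable_rotated_mul (G : Matrix A A ℂ) (a b c d : A) :
    Integrable (fun U => rotated G U a b * rotated G U c d) (unitaryHaar A) :=
  integrable_unitaryHaar ((continuous_rotated_apply G a b).mul (continuous_rotated_apply G c d))

end HaarMoments

/-! ### Evaluation of the first and second Haar moments. -/

section HaarMomentFormulas

variable {A : Type} [Fintype A] [DecidableEq A]

theorem integral_sum_rotated_mul {ι : Type} [Fintype ι] (G : Matrix A A ℂ) (c : ι → ℂ)
    (p q r s : ι → A) :
    ∫ U, ∑ k, c k * (rotated G U (p k) (q k) * rotated G U (r k) (s k)) ∂(unitaryHaar A) =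
      ∑ k, c k * rotatedMoment G (p k) (q k) (r k) (s k) := by
  rw [integral_finsetSum _ fun k _ => (integrable_rotated_mul G _ _ _ _).const_mul _]
  exact Finset.sum_congr rfl fun k _ => integral_const_mul _ _

/-- Phases and permutations alone do not relate these moments. Invariance under the rotation mixing
`x` and `y` expands the left side into sixteen products; with `m` the moment on the left, the
survivors say `m = (m + m_xxyy + m_xyyx) / 2`. -/
theorem rotatedMoment_diag (G : Matrix A A ℂ) {x y : A} (hxy : x ≠ y) :
    rotatedMoment G x x x x = rotatedMoment G x x y y + rotatedMoment G x y y x := by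
  have hsw := rotatedMoment_perm G (Equiv.swap x y)
  have h1 : rotatedMoment G y y y y = rotatedMoment G x x x x := by
    rw [hsw x x x x, Equiv.swap_apply_left]
  have h2 : rotatedMoment G y y x x = rotatedMoment G x x y y := by
    rw [hsw x x y y, Equiv.swap_apply_left, Equiv.swap_apply_right]
  have h3 : rotatedMoment G y x x y = rotatedMoment G x y y x := by
    rw [hsw x y y x, Equiv.swap_apply_left, Equiv.swap_apply_right]
  let c : Fin 4 → ℂ := ![1 / 2, 1 / 2, Complex.I / 2, -Complex.I / 2]
  let p : Fin 4 → A := ![x, y, x, y]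
  let q : Fin 4 → A := ![x, y, y, x]
  have h : rotatedMoment G x x x x =
      ∑ k : Fin 4 × Fin 4, (c k.1 * c k.2) * rotatedMoment G (p k.1) (q k.1) (p k.2) (q k.2) := by
    rw [← integral_sum_rotated_mul, rotatedMoment, integral_rotated G (fun M => M x x * M x x)
      (pairRotation_mem_unitaryGroup hxy)]
    refine integral_congr_ae (Filter.Eventually.of_forall fun U => ?_)
    simp only [pairRotation_conj_apply hxy, Fintype.sum_prod_type, Fin.sum_univ_four, c, p, q]
    simp
    ring
  simp only [Fintype.sum_prod_type, Fin.sum_univ_four, c, p, q] at h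
  have hz : ∀ {a b c d : A}, ¬ (a = b ∧ c = d) → ¬ (a = d ∧ c = b) →
    rotatedMoment G a b c d = 0 := rotatedMoment_eq_zero G
  simp [hz, hxy, hxy.symm, h1, h2, h3] at h
  linear_combination 2 * h - rotatedMoment G x y y x * Complex.I_sq

/-- The average of `Uᴴ G U ⊗ Uᴴ G U` commutes with all `V ⊗ V`, so it lies in the span of the
identity and the swap. The two coefficients are read off at a pair of distinct indices. -/
theorem exists_rotatedMoment_eq [Nontrivial A] (G : Matrix A A ℂ) :
    ∃ u v : ℂ, ∀ a b c d, rotatedMoment G a b c d =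
      u * ((if a = b then 1 else 0) * (if c = d then 1 else 0)) +
      v * ((if a = d then 1 else 0) * (if c = b then 1 else 0)) := by
  obtain ⟨x, y, hxy⟩ := exists_pair_ne A
  refine ⟨rotatedMoment G x x y y, rotatedMoment G x y y x, fun a b c d => ?_⟩
  have h1 : ∀ a b, a ≠ b → rotatedMoment G a a b b = rotatedMoment G x x y y := by
    intro a b hab
    obtain ⟨σ, hx, hy⟩ := exists_perm_map_pair hxy hab
    rw [rotatedMoment_perm G σ x x y y, hx, hy]
  have h2 : ∀ a b, a ≠ b → rotatedMoment G a b b a = rotatedMoment G x y y x := by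
    intro a b hab
    obtain ⟨σ, hx, hy⟩ := exists_perm_map_pair hxy hab
    rw [rotatedMoment_perm G σ x y y x, hx, hy]
  by_cases hA : a = b ∧ c = d
  · obtain ⟨rfl, rfl⟩ := hA
    by_cases hac : a = c
    · subst hac
      obtain ⟨b, hb⟩ := exists_ne a
      rw [rotatedMoment_diag G hb.symm, h1 _ _ hb.symm, h2 _ _ hb.symm]
      simp
    · rw [h1 _ _ hac]
      simp [hac]
  · by_cases hB : a = d ∧ c = b
    · obtain ⟨rfl, rfl⟩ := hB
      have hac : a ≠ c := fun h => hA ⟨h, h.symm⟩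
      rw [h2 _ _ hac]
      simp [hac]
    · rw [rotatedMoment_eq_zero G hA hB]
      have e1 : ((if a = b then 1 else 0) * (if c = d then 1 else 0) : ℂ) = 0 := by
        by_cases h : a = b <;> by_cases h' : c = d <;> simp_all
      have e2 : ((if a = d then 1 else 0) * (if c = b then 1 else 0) : ℂ) = 0 := by
        by_cases h : a = d <;> by_cases h' : c = b <;> simp_all
      rw [e1, e2]
      simp

/-- `(Tr G)²` does not depend on the rotation. With `Tr G² = Tr G` for a projector it supplies the
two linear equations that determine `u` and `v`. -/
theorem sum_rotatedMoment_diag (G : Matrix A A ℂ) :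
    ∑ k : A × A, rotatedMoment G k.1 k.1 k.2 k.2 = G.trace ^ 2 := by
  have h := integral_sum_rotated_mul G (fun _ : A × A => (1 : ℂ))
    Prod.fst Prod.fst Prod.snd Prod.snd
  simp only [one_mul] at h
  rw [← h]
  have : ∀ U : unitaryGroup A ℂ,
      ∑ k : A × A, rotated G U k.1 k.1 * rotated G U k.2 k.2 = G.trace ^ 2 := by
    intro U
    rw [← trace_rotated G U, sq, Matrix.trace, Fintype.sum_mul_sum, Fintype.sum_prod_type]
    rfl
  simp [this]

theorem sum_rotatedMoment_swap {G : Matrix A A ℂ} (hG : G * G = G) :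
    ∑ k : A × A, rotatedMoment G k.1 k.2 k.2 k.1 = G.trace := by
  have h := integral_sum_rotated_mul G (fun _ : A × A => (1 : ℂ))
    Prod.fst Prod.snd Prod.snd Prod.fst
  simp only [one_mul] at h
  rw [← h]
  have : ∀ U : unitaryGroup A ℂ,
      ∑ k : A × A, rotated G U k.1 k.2 * rotated G U k.2 k.1 = G.trace := by
    intro U
    rw [← trace_rotated G U]
    conv_rhs => rw [← rotated_mul_self hG U]
    rw [Matrix.trace, Fintype.sum_prod_type]
    rfl
  simp [this]

omit [DecidableEq A] in
theorem trace_mul_mul_mul_conjTranspose (M X N : Matrix A A ℂ) :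
    (M * X * N * Xᴴ).trace =
      ∑ k : A × A × A × A, X k.2.1 k.2.2.1 * star (X k.1 k.2.2.2) *
        (M k.1 k.2.1 * N k.2.2.1 k.2.2.2) := by
  simp only [Fintype.sum_prod_type]
  simp only [Matrix.trace, diag_apply, Matrix.mul_apply, Finset.sum_mul, conjTranspose_apply]
  refine Finset.sum_congr rfl fun a _ => ?_
  rw [Finset.sum_comm]
  conv_lhs => enter [2, c]; rw [Finset.sum_comm]
  rw [Finset.sum_comm]
  refine Finset.sum_congr rfl fun b _ => Finset.sum_congr rfl fun c _ =>
    Finset.sum_congr rfl fun d _ => by ring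

theorem integral_trace_rotated_mul_of_eq {G : Matrix A A ℂ} {u v : ℂ}
    (h : ∀ a b c d, rotatedMoment G a b c d =
      u * ((if a = b then 1 else 0) * (if c = d then 1 else 0)) +
      v * ((if a = d then 1 else 0) * (if c = b then 1 else 0))) (X : Matrix A A ℂ) :
    ∫ U, (rotated G U * X * rotated G U * Xᴴ).trace ∂(unitaryHaar A) =
      u * hsSq X + v * (X.trace * star X.trace) := by
  simp only [trace_mul_mul_mul_conjTranspose]
  rw [integral_sum_rotated_mul]
  simp only [h, Fintype.sum_prod_type, mul_add, Finset.sum_add_distrib]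
  congr 1
  · rw [← trace_conjTranspose_mul_self, trace_conjTranspose_mul]
    simp only [mul_ite, mul_one, mul_zero, Finset.sum_ite_eq, Finset.mem_univ, if_true,
      Finset.mul_sum]
    simp
    exact Finset.sum_congr rfl fun i _ => Finset.sum_congr rfl fun j _ => by ring
  · simp only [mul_ite, mul_one, mul_zero, Matrix.trace, diag_apply, star_sum]
    simp
    rw [Finset.sum_comm, Finset.sum_mul_sum, Finset.mul_sum]
    refine Finset.sum_congr rfl fun i _ => ?_
    rw [Finset.mul_sum]
    exact Finset.sum_congr rfl fun j _ => by ring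

theorem integral_trace_rotated_mul_le [Nontrivial A] {G : Matrix A A ℂ} (hG : G * G = G) {k : ℕ}
    (hk : G.trace = k) (X : Matrix A A ℂ) :
    (∫ U, (rotated G U * X * rotated G U * Xᴴ).trace ∂(unitaryHaar A)).re ≤
      (k / Fintype.card A : ℝ) ^ 2 * hsSq X + k / (Fintype.card A : ℝ) ^ 2 * ‖X.trace‖ ^ 2 := by
  obtain ⟨u, v, h⟩ := exists_rotatedMoment_eq G
  set d := Fintype.card A with hd
  have hd2 : 2 ≤ d := Fintype.one_lt_card
  have hkd : k ≤ d := by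
    rw [trace_eq_rank_of_isIdempotentElem hG] at hk
    have hk' : G.rank = k := by exact_mod_cast hk
    rw [← hk']
    exact G.rank_le_card_width
  have e1 : u * (d : ℂ) ^ 2 + v * d = (k : ℂ) ^ 2 := by
    have := sum_rotatedMoment_diag G
    rw [hk] at this
    rw [← this]
    simp [h, Fintype.sum_prod_type, Finset.sum_add_distrib, ← hd]
    ring
  have e2 : u * d + v * (d : ℂ) ^ 2 = k := by
    have := sum_rotatedMoment_swap hG
    rw [hk] at this
    rw [← this]
    simp [h, Fintype.sum_prod_type, Finset.sum_add_distrib, ← hd]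
    ring
  have hdR : (2 : ℝ) ≤ d := by exact_mod_cast hd2
  have hkR : (k : ℝ) ≤ d := by exact_mod_cast hkd
  have hk0 : (0 : ℝ) ≤ k := k.cast_nonneg
  have hk1 : (k : ℝ) ≤ (k : ℝ) ^ 2 := by exact_mod_cast Nat.le_self_pow two_ne_zero k
  have r1 : u.re * (d : ℝ) ^ 2 + v.re * d = (k : ℝ) ^ 2 := by
    have := congrArg Complex.re e1
    rw [← Complex.ofReal_natCast, ← Complex.ofReal_natCast, ← Complex.ofReal_pow,
      ← Complex.ofReal_pow, Complex.add_re, Complex.re_mul_ofReal, Complex.re_mul_ofReal,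
      Complex.ofReal_re] at this
    exact this
  have r2 : u.re * d + v.re * (d : ℝ) ^ 2 = k := by
    have := congrArg Complex.re e2
    rw [← Complex.ofReal_natCast, ← Complex.ofReal_natCast, ← Complex.ofReal_pow,
      Complex.add_re, Complex.re_mul_ofReal, Complex.re_mul_ofReal, Complex.ofReal_re] at this
    exact this
  have hd0 : (0 : ℝ) < d := by linarith
  have hd3 : (0 : ℝ) < (d : ℝ) * ((d : ℝ) ^ 2 - 1) := mul_pos hd0 (by nlinarith)
  -- Solving the two equations gives `u = (k² d - k) / (d (d² - 1))` and `v = (k d - k²) / (d (d² -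
  -- 1))`. The bound on `u` amounts to `k ≤ d`, the bound on `v` to `k = 0` or `k d ≥ 1`.
  have hu : u.re ≤ (k / d : ℝ) ^ 2 := by
    have hu' : u.re = ((k : ℝ) ^ 2 * d - k) / (d * ((d : ℝ) ^ 2 - 1)) := by
      rw [eq_div_iff hd3.ne']
      linear_combination (d : ℝ) * r1 - r2
    rw [hu', div_pow, div_le_div_iff₀ hd3 (by positivity)]
    nlinarith [mul_le_mul_of_nonneg_right hkR (mul_nonneg hk0 hd0.le)]
  have hv : v.re ≤ k / (d : ℝ) ^ 2 := by
    have hv' : v.re = ((k : ℝ) * d - (k : ℝ) ^ 2) / (d * ((d : ℝ) ^ 2 - 1)) := by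
      rw [eq_div_iff hd3.ne']
      linear_combination (d : ℝ) * r2 - r1
    rw [hv', div_le_div_iff₀ hd3 (by positivity)]
    have h1 : (1 : ℝ) ≤ d := by linarith
    have h3 : (k : ℝ) * d ≤ (k : ℝ) ^ 2 * (d : ℝ) ^ 2 :=
      mul_le_mul hk1 (by nlinarith) hd0.le (sq_nonneg _)
    rcases Nat.eq_zero_or_pos k with h0 | h0
    · simp [h0]
    · have hk1' : (1 : ℝ) ≤ k := by exact_mod_cast h0
      have h4 : (1 : ℝ) ≤ (k : ℝ) * d := by nlinarith
      nlinarith [mul_le_mul_of_nonneg_left h4 (mul_nonneg hk0 hd0.le)]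
  have hre : (u * hsSq X + v * (X.trace * star X.trace)).re =
      u.re * hsSq X + v.re * ‖X.trace‖ ^ 2 := by
    rw [RCLike.star_def, Complex.mul_conj', ← Complex.ofReal_pow, Complex.add_re,
      Complex.re_mul_ofReal, Complex.re_mul_ofReal]
  rw [integral_trace_rotated_mul_of_eq h, hre]
  exact add_le_add (mul_le_mul_of_nonneg_right hu (hsSq_nonneg X))
    (mul_le_mul_of_nonneg_right hv (sq_nonneg _))

/-- Swaps make the diagonal means equal, with total `Tr G`; a phase at `a` kills the off-diagonal
ones. -/
theorem integral_rotated_apply (G : Matrix A A ℂ) (a b : A) :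
    ∫ U, rotated G U a b ∂(unitaryHaar A) = if a = b then G.trace / Fintype.card A else 0 := by
  split_ifs with hab
  · subst hab
    have h : ∀ b, ∫ U, rotated G U b b ∂(unitaryHaar A) =
        ∫ U, rotated G U a a ∂(unitaryHaar A) := by
      intro b
      rw [integral_rotated G (fun M => M a a) (one_submatrix_mem_unitaryGroup (Equiv.swap a b))]
      refine integral_congr_ae (Filter.Eventually.of_forall fun U => ?_)
      simp only [one_submatrix_conj_apply, Equiv.swap_apply_left]
    have hsum : ∑ b, ∫ U, rotated G U b b ∂(unitaryHaar A) = G.trace := by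
      rw [← integral_finsetSum _ fun b _ => integrable_unitaryHaar (continuous_rotated_apply G b b)]
      have : ∀ U : unitaryGroup A ℂ, ∑ b, rotated G U b b = G.trace := fun U => trace_rotated G U
      simp [this]
    simp only [h, Finset.sum_const, Finset.card_univ, nsmul_eq_mul] at hsum
    have : Nonempty A := ⟨a⟩
    rw [eq_div_iff (by exact_mod_cast Fintype.card_ne_zero), ← hsum, mul_comm]
  · have hI : (-Complex.I) ≠ 1 := fun h => by simpa using congrArg Complex.re h
    refine eq_zero_of_eq_mul (w := -Complex.I) ?_ hI
    conv_lhs => rw [integral_rotated G (fun M => M a b) (phase_mem_unitaryGroup a)]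
    rw [← integral_const_mul]
    refine integral_congr_ae (Filter.Eventually.of_forall fun U => ?_)
    have hba : b ≠ a := fun h => hab h.symm
    simp only [phase_conj_apply, if_true, if_neg hba, mul_one]

theorem integral_trace_rotated_mul (G X : Matrix A A ℂ) :
    ∫ U, (rotated G U * X).trace ∂(unitaryHaar A) = G.trace / Fintype.card A * X.trace := by
  simp only [Matrix.trace, diag_apply, Matrix.mul_apply]
  rw [integral_finsetSum _ fun a _ => integrable_finsetSum _ fun b _ =>
    (integrable_unitaryHaar (continuous_rotated_apply G a b)).mul_const _]
  rw [Finset.mul_sum]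
  refine Finset.sum_congr rfl fun a _ => ?_
  rw [integral_finsetSum _ fun b _ =>
    (integrable_unitaryHaar (continuous_rotated_apply G a b)).mul_const _]
  simp only [integral_mul_const, integral_rotated_apply]
  simp [Matrix.trace]

/-! ### Mean square deviation of a randomly compressed operator. -/

section Variance

variable {Y : Type} [Fintype Y] [DecidableEq Y]

omit [DecidableEq Y] in
theorem conj_mul_coe_eq_rotated (Q : Matrix Y A ℂ) (U : unitaryGroup A ℂ) :
    (Q * (U : Matrix A A ℂ))ᴴ * (Q * (U : Matrix A A ℂ)) = rotated (Qᴴ * Q) U := by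
  rw [rotated, conjTranspose_mul]
  simp only [Matrix.mul_assoc]

theorem hsSq_smul_one (c : ℂ) : hsSq (c • (1 : Matrix Y Y ℂ)) = ‖c‖ ^ 2 * Fintype.card Y := by
  have : hsSq (c • (1 : Matrix Y Y ℂ)) = ‖c‖ ^ 2 * hsSq (1 : Matrix Y Y ℂ) := by
    simp only [hsSq, Matrix.smul_apply, norm_smul, mul_pow, Finset.mul_sum]
  rw [this, hsSq_eq, conjTranspose_one, Matrix.one_mul, Matrix.trace_one]
  simp

omit [DecidableEq Y] in
theorem trace_conj_mul_coe (Q : Matrix Y A ℂ) (U : unitaryGroup A ℂ) (X : Matrix A A ℂ) :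
    (Q * (U : Matrix A A ℂ) * X * (Q * (U : Matrix A A ℂ))ᴴ).trace =
      (rotated (Qᴴ * Q) U * X).trace := by
  rw [Matrix.trace_mul_comm, ← Matrix.mul_assoc, conj_mul_coe_eq_rotated]

omit [DecidableEq A] [DecidableEq Y] in
theorem hsSq_mul_mul_conjTranspose (K : Matrix Y A ℂ) (X : Matrix A A ℂ) :
    hsSq (K * X * Kᴴ) = (Kᴴ * K * X * (Kᴴ * K) * Xᴴ).trace.re := by
  have h : K * X * Kᴴ * (K * X * Kᴴ)ᴴ = K * (X * (Kᴴ * K) * Xᴴ * Kᴴ) := by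
    simp only [conjTranspose_mul, conjTranspose_conjTranspose, Matrix.mul_assoc]
  rw [← hsSq_conjTranspose, hsSq_eq, conjTranspose_conjTranspose, h, Matrix.trace_mul_comm,
    Matrix.mul_assoc, Matrix.trace_mul_comm]
  simp only [Matrix.mul_assoc]

theorem hsSq_conj_sub (Q : Matrix Y A ℂ) (U : unitaryGroup A ℂ) (X : Matrix A A ℂ) (c : ℂ) :
    hsSq (Q * (U : Matrix A A ℂ) * X * (Q * (U : Matrix A A ℂ))ᴴ - c • 1) =
      (rotated (Qᴴ * Q) U * X * rotated (Qᴴ * Q) U * Xᴴ).trace.re + ‖c‖ ^ 2 * Fintype.card Y -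
        2 * (star c * (rotated (Qᴴ * Q) U * X).trace).re := by
  rw [hsSq_sub, hsSq_mul_mul_conjTranspose, conj_mul_coe_eq_rotated, hsSq_smul_one,
    ← trace_conjTranspose_mul_comm_re,
    conjTranspose_smul, conjTranspose_one, Matrix.smul_mul, Matrix.one_mul, Matrix.trace_smul,
    trace_conj_mul_coe, smul_eq_mul]

/-- On expanding the square, the `|Tr X|²` terms of the second moment and of the constant are each
at most `k |Tr X|² / d²`, and the cross term is exactly minus twice that. Only `(k / d)² ‖X‖₂²`
survives. -/
theorem integral_hsSq_conj_sub_le {Q : Matrix Y A ℂ} (hQ : (Qᴴ * Q) * (Qᴴ * Q) = Qᴴ * Q)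
    (hrank : (Qᴴ * Q).rank = Fintype.card Y) (hY : 1 ≤ Fintype.card Y) (X : Matrix A A ℂ) :
    ∫ U : unitaryGroup A ℂ, hsSq (Q * (U : Matrix A A ℂ) * X * (Q * (U : Matrix A A ℂ))ᴴ -
      (X.trace / Fintype.card A) • 1) ∂(unitaryHaar A) ≤
      (Fintype.card Y / Fintype.card A : ℝ) ^ 2 * hsSq X := by
  have htr : (Qᴴ * Q).trace = Fintype.card Y := by
    rw [trace_eq_rank_of_isIdempotentElem hQ, hrank]
  set G := Qᴴ * Q with hG
  set k := Fintype.card Y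
  set d := Fintype.card A with hd
  have hkd : k ≤ d := by
    rw [← hrank]
    exact G.rank_le_card_width
  have hd0 : (0 : ℝ) < d := by exact_mod_cast hY.trans hkd
  have hc2 : Continuous fun U => (rotated G U * X * rotated G U * Xᴴ).trace := by
    have := continuous_rotated G
    fun_prop
  have hc1 : Continuous fun U => (rotated G U * X).trace := by
    have := continuous_rotated G
    fun_prop
  have hsecond : ∫ U, (rotated G U * X * rotated G U * Xᴴ).trace.re ∂(unitaryHaar A) ≤
      (k / d : ℝ) ^ 2 * hsSq X + k / (d : ℝ) ^ 2 * ‖X.trace‖ ^ 2 := by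
    -- The moment formula needs two distinct indices, so dimension one is separate: there the
    -- rotated projector is 1.
    rcases subsingleton_or_nontrivial A with hA | hA
    · have hd1 : d = 1 := le_antisymm (Fintype.card_le_one_iff_subsingleton.mpr hA) (hY.trans hkd)
      have hk1 : k = 1 := le_antisymm (hkd.trans hd1.le) hY
      have hpt : ∀ U : unitaryGroup A ℂ,
          (rotated G U * X * rotated G U * Xᴴ).trace.re ≤ hsSq X := by
        intro U
        obtain ⟨a, ha⟩ := Fintype.card_eq_one_iff.mp hd1
        have : Unique A := ⟨⟨a⟩, ha⟩
        have h1 : rotated G U = 1 := by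
          ext i j
          have := trace_rotated G U
          rw [htr, hk1] at this
          simp only [Matrix.trace, diag_apply, Finset.univ_unique, Finset.sum_singleton] at this
          rw [Subsingleton.elim i default, Subsingleton.elim j default, this]
          simp
        rw [h1, Matrix.one_mul, Matrix.mul_one, ← hsSq_conjTranspose, hsSq_eq,
          conjTranspose_conjTranspose]
      calc _ ≤ ∫ _ : unitaryGroup A ℂ, hsSq X ∂(unitaryHaar A) :=
            integral_mono (integrable_unitaryHaar (Complex.continuous_re.comp hc2))
              (integrable_const _) hpt
        _ = hsSq X := by simp
        _ ≤ _ := by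
          rw [hd1, hk1]
          simp
    · have h := integral_trace_rotated_mul_le hQ htr X
      have h2 := integral_re (integrable_unitaryHaar hc2)
      simp only [RCLike.re_eq_complex_re] at h2
      rwa [h2]
  set c : ℂ := X.trace / d with hc
  have hfirst : ∫ U, (star c * (rotated G U * X).trace).re ∂(unitaryHaar A) =
      k / (d : ℝ) ^ 2 * ‖X.trace‖ ^ 2 := by
    have h2 := integral_re (integrable_unitaryHaar (hc1.const_mul (star c)))
    simp only [RCLike.re_eq_complex_re] at h2
    rw [h2, integral_const_mul, integral_trace_rotated_mul, htr, hc]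
    have : star (X.trace / (d : ℂ)) * ((k : ℂ) / d * X.trace) =
        ((k / (d : ℝ) ^ 2 * ‖X.trace‖ ^ 2 : ℝ) : ℂ) := by
      have h3 := Complex.conj_mul' X.trace
      rw [RCLike.star_def, map_div₀, map_natCast]
      push_cast
      rw [← h3]
      ring
    rw [this, Complex.ofReal_re]
  have hcn : ‖c‖ ^ 2 = ‖X.trace‖ ^ 2 / (d : ℝ) ^ 2 := by
    rw [hc, norm_div, div_pow, Complex.norm_natCast]
  simp only [hsSq_conj_sub]
  rw [integral_sub, integral_add, integral_const_mul (2 : ℝ), hfirst]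
  · simp only [integral_const, probReal_univ, one_smul]
    rw [hcn]
    have : ‖X.trace‖ ^ 2 / (d : ℝ) ^ 2 * k = k / (d : ℝ) ^ 2 * ‖X.trace‖ ^ 2 := by ring
    linarith
  · exact integrable_unitaryHaar (Complex.continuous_re.comp hc2)
  · exact integrable_const _
  · exact (integrable_unitaryHaar (Complex.continuous_re.comp hc2)).add (integrable_const _)
  · exact (integrable_unitaryHaar (Complex.continuous_re.comp (hc1.const_mul (star c)))).const_mul 2

end Variance

end HaarMomentFormulas

/-! ### Reduced states -/

section Reduced

variable {A B R X Y : Type} [Fintype B]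

/-- The matrix of a tripartite vector with respect to the bipartition `AR : B`. -/
def cutMatrix (φ : A × B × R → ℂ) : Matrix (A × R) B ℂ := fun x b => φ (x.1, b, x.2)

theorem reduce13_ketbra (φ : A × B × R → ℂ) :
    reduce13 (ketbra φ) = cutMatrix φ * (cutMatrix φ)ᴴ := by
  ext x y
  rw [reduce13, Matrix.mul_apply]
  rfl

theorem posSemidef_reduce13_ketbra [Fintype A] [Fintype R] (φ : A × B × R → ℂ) :
    (reduce13 (ketbra φ)).PosSemidef := by
  rw [reduce13_ketbra]
  exact posSemidef_self_mul_conjTranspose _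

theorem hsSq_cutMatrix [Fintype A] [Fintype R] (φ : A × B × R → ℂ) :
    (hsSq (cutMatrix φ) : ℂ) = star φ ⬝ᵥ φ := by
  rw [star_dotProduct_self, hsSq]
  congr 1
  simp only [Fintype.sum_prod_type, cutMatrix]
  refine Finset.sum_congr rfl fun a _ => ?_
  rw [Finset.sum_comm]

theorem trace_reduce13_ketbra [Fintype A] [Fintype R] (φ : A × B × R → ℂ) :
    (reduce13 (ketbra φ)).trace = star φ ⬝ᵥ φ := by
  rw [reduce13_ketbra, Matrix.trace_mul_comm, trace_conjTranspose_mul_self, hsSq_cutMatrix]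

theorem reduce13_ketbra_smul (c : ℂ) (φ : A × B × R → ℂ) :
    reduce13 (ketbra (c • φ)) = (‖c‖ ^ 2 : ℝ) • reduce13 (ketbra φ) := by
  ext x y
  simp only [reduce13, ketbra, vecMulVec_apply, Pi.smul_apply, Pi.star_apply, smul_eq_mul,
    Matrix.smul_apply, Complex.real_smul, Finset.mul_sum, star_mul']
  refine Finset.sum_congr rfl fun b _ => ?_
  have := Complex.mul_conj' c
  rw [RCLike.star_def]
  push_cast
  rw [← this]
  ring

omit [Fintype B] in
theorem reduce2_ketbra [Fintype A] [Fintype R] (φ : A × B × R → ℂ) :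
    reduce2 (ketbra φ) = ((cutMatrix φ)ᴴ * cutMatrix φ)ᵀ := by
  ext b b'
  simp only [reduce2, ketbra, vecMulVec_apply, Pi.star_apply, transpose_apply, Matrix.mul_apply,
    Fintype.sum_prod_type, conjTranspose_apply, cutMatrix]
  exact Finset.sum_congr rfl fun a _ => Finset.sum_congr rfl fun r _ => mul_comm _ _

/-- Up to a transpose, `ρ_AR = C Cᴴ` and `ρ_B = Cᴴ C` for the same matrix `C`. This turns the
hypothesis on the purity of `B` into a Hilbert-Schmidt bound on `AR`. -/
theorem trace_reduce2_sq [Fintype A] [Fintype R] [DecidableEq B] (φ : A × B × R → ℂ) :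
    ((reduce2 (ketbra φ)) ^ 2).trace.re = hsSq (reduce13 (ketbra φ)) := by
  rw [reduce2_ketbra, sq, ← transpose_mul, trace_transpose, hsSq_eq,
    (posSemidef_reduce13_ketbra φ).1.eq, reduce13_ketbra]
  congr 1
  rw [Matrix.mul_assoc, Matrix.trace_mul_comm]
  simp only [Matrix.mul_assoc]

theorem reduce3_ketbra [Fintype A] (φ : A × B × R → ℂ) :
    reduce3 (ketbra φ) = (Matrix.of fun (r : R) (x : A × B) => φ (x.1, x.2, r)) *
      (Matrix.of fun (r : R) (x : A × B) => φ (x.1, x.2, r))ᴴ := by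
  ext r r'
  rw [reduce3, Matrix.mul_apply, Fintype.sum_prod_type]
  rfl

theorem posSemidef_reduce3_ketbra [Fintype A] [Fintype R] (φ : A × B × R → ℂ) :
    (reduce3 (ketbra φ)).PosSemidef := by
  rw [reduce3_ketbra]
  exact posSemidef_self_mul_conjTranspose _

theorem trace_reduce3_ketbra [Fintype A] [Fintype R] (φ : A × B × R → ℂ) :
    (reduce3 (ketbra φ)).trace = star φ ⬝ᵥ φ := by
  rw [← trace_reduce13_ketbra, Matrix.trace, Matrix.trace, Fintype.sum_prod_type, Finset.sum_comm]
  rfl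

end Reduced

/-! ### Effect of an operator on `A` on the reduced states. -/

section LocalOperator

variable {A B R X : Type} [Fintype A] [Fintype B] [DecidableEq B] [Fintype R] [DecidableEq R]

theorem kronecker_one_mulVec_apply (P : Matrix X A ℂ) (ψ : A × B × R → ℂ) (i : X) (b : B) (r : R) :
    ((P ⊗ₖ (1 : Matrix (B × R) (B × R) ℂ)) *ᵥ ψ) (i, b, r) = ∑ a, P i a * ψ (a, b, r) := by
  simp only [mulVec, dotProduct, Fintype.sum_prod_type, kroneckerMap_apply]
  refine Finset.sum_congr rfl fun a _ => ?_
  simp [Matrix.one_apply, Prod.ext_iff, ite_and]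

/-- The block of the reduced operator on `AR` at the indices `r, r'` of `R`. -/
def reducedBlock (ψ : A × B × R → ℂ) (r r' : R) : Matrix A A ℂ :=
  fun a a' => reduce13 (ketbra ψ) (a, r) (a', r')

/-- An operator on `A` acts on each `R`-block separately, so estimates on `AR` reduce to operators
on `A` alone. -/
theorem reduce13_ketbra_kronecker (P : Matrix X A ℂ) (ψ : A × B × R → ℂ) (x y : X × R) :
    reduce13 (ketbra ((P ⊗ₖ (1 : Matrix (B × R) (B × R) ℂ)) *ᵥ ψ)) x y =
      (P * reducedBlock ψ x.2 y.2 * Pᴴ) x.1 y.1 := by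
  simp only [reduce13, ketbra, vecMulVec_apply, Pi.star_apply, kronecker_one_mulVec_apply,
    Matrix.mul_apply, reducedBlock, conjTranspose_apply, star_sum, star_mul', Finset.mul_sum,
    Finset.sum_mul]
  rw [Finset.sum_comm]
  conv_lhs => enter [2, a]; rw [Finset.sum_comm]
  exact Finset.sum_congr rfl fun a _ => Finset.sum_congr rfl fun b _ =>
    Finset.sum_congr rfl fun c _ => by ring

omit [DecidableEq B] [Fintype R] [DecidableEq R] in
theorem trace_reducedBlock (ψ : A × B × R → ℂ) (r r' : R) :
    (reducedBlock ψ r r').trace = reduce3 (ketbra ψ) r r' := rfl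

omit [DecidableEq B] [DecidableEq R] in
theorem sum_hsSq_reducedBlock (ψ : A × B × R → ℂ) :
    ∑ r, ∑ r', hsSq (reducedBlock ψ r r') = hsSq (reduce13 (ketbra ψ)) := by
  simp only [hsSq, reducedBlock, Fintype.sum_prod_type]
  conv_rhs => rw [Finset.sum_comm]
  refine Finset.sum_congr rfl fun r _ => ?_
  rw [Finset.sum_comm]
  exact Finset.sum_congr rfl fun a _ => Finset.sum_comm

variable [Fintype X]

theorem outcomeProb_eq (P : Matrix X A ℂ) (ψ : A × B × R → ℂ) :
    outcomeProb P ψ =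
      (reduce13 (ketbra ((P ⊗ₖ (1 : Matrix (B × R) (B × R) ℂ)) *ᵥ ψ))).trace.re := by
  rw [trace_reduce13_ketbra, star_dotProduct_mulVec_conjTranspose_mul, conjTranspose_kronecker,
    ← mul_kronecker_mul, conjTranspose_one, Matrix.one_mul, outcomeProb]

theorem outcomeProb_nonneg (P : Matrix X A ℂ) (ψ : A × B × R → ℂ) : 0 ≤ outcomeProb P ψ := by
  rw [outcomeProb_eq]
  exact posSemidef_trace_re_nonneg (posSemidef_reduce13_ketbra _)

theorem outcomeProb_eq_sum (P : Matrix X A ℂ) (ψ : A × B × R → ℂ) :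
    outcomeProb P ψ = (∑ r, (P * reducedBlock ψ r r * Pᴴ).trace).re := by
  rw [outcomeProb_eq, Matrix.trace, Fintype.sum_prod_type, Finset.sum_comm]
  simp only [diag_apply, reduce13_ketbra_kronecker]
  rfl

theorem outcomeProb_smul_reduce13_postState (P : Matrix X A ℂ) (ψ : A × B × R → ℂ) :
    outcomeProb P ψ • reduce13 (ketbra (postState P ψ)) =
      reduce13 (ketbra ((P ⊗ₖ (1 : Matrix (B × R) (B × R) ℂ)) *ᵥ ψ)) := by
  have hp := outcomeProb_nonneg P ψ
  rw [postState, reduce13_ketbra_smul, smul_smul]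
  -- For `p = 0` the right side is positive semidefinite of trace 0, hence 0, in agreement with the
  -- default post-measurement vector.
  rcases hp.eq_or_lt with h0 | h0
  · have h1 := posSemidef_reduce13_ketbra ((P ⊗ₖ (1 : Matrix (B × R) (B × R) ℂ)) *ᵥ ψ)
    have h2 : reduce13 (ketbra ((P ⊗ₖ (1 : Matrix (B × R) (B × R) ℂ)) *ᵥ ψ)) = 0 := by
      rw [← h1.trace_eq_zero_iff, ← posSemidef_trace_eq h1, ← outcomeProb_eq, ← h0,
        Complex.ofReal_zero]
    rw [h2, smul_zero]
  · rw [norm_inv, Complex.norm_real, Real.norm_of_nonneg (Real.sqrt_nonneg _), inv_pow,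
      Real.sq_sqrt hp, mul_inv_cancel₀ h0.ne', one_smul]

variable [DecidableEq X]

theorem outcomeProb_mul_traceNorm (P : Matrix X A ℂ) (ψ : A × B × R → ℂ)
    (M : Matrix (X × R) (X × R) ℂ) :
    outcomeProb P ψ * traceNorm (reduce13 (ketbra (postState P ψ)) - M) =
      traceNorm (reduce13 (ketbra ((P ⊗ₖ (1 : Matrix (B × R) (B × R) ℂ)) *ᵥ ψ)) -
        outcomeProb P ψ • M) := by
  rw [← traceNorm_smul (outcomeProb_nonneg P ψ), smul_sub, outcomeProb_smul_reduce13_postState]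

end LocalOperator

/-! ### The average quantum error of a random measurement -/

section AverageError

variable {A B R : Type} [Fintype A] [DecidableEq A] [Fintype B] [DecidableEq B]
  [Fintype R] [DecidableEq R]

theorem traceNorm_real_smul {X : Type} [Fintype X] [DecidableEq X] (c : ℝ) (M : Matrix X X ℂ) :
    traceNorm (c • M) = |c| * traceNorm M := by
  rcases le_total 0 c with h | h
  · rw [traceNorm_smul h, abs_of_nonneg h]
  · rw [← traceNorm_neg, ← neg_smul, traceNorm_smul (neg_nonneg.mpr h), abs_of_nonpos h]

/-- Replacing the weight of a normalised reference state by the trace of the compared operator at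
most doubles the trace distance. -/
theorem traceNorm_sub_trace_smul_le {X : Type} [Fintype X] [DecidableEq X] {S T : Matrix X X ℂ}
    (hT : T.PosSemidef) (hT1 : T.trace = 1) (c : ℝ) :
    traceNorm (S - S.trace.re • T) ≤ 2 * traceNorm (S - c • T) := by
  have h1 : S - S.trace.re • T = (S - c • T) + (c - S.trace.re) • T := by
    rw [sub_smul]
    abel
  have h2 : |c - S.trace.re| ≤ traceNorm (S - c • T) := by
    refine le_trans ?_ (norm_trace_le_traceNorm _)
    rw [abs_sub_comm]
    have : S.trace.re - c = (S - c • T).trace.re := by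
      rw [Matrix.trace_sub, Matrix.trace_smul, hT1, Complex.sub_re]
      simp
    rw [this]
    exact Complex.abs_re_le_norm _
  have h3 := traceNorm_add_le (S - c • T) ((c - S.trace.re) • T)
  rw [traceNorm_real_smul, traceNorm_of_posSemidef hT, hT1, Complex.one_re, mul_one] at h3
  rw [h1]
  linarith

theorem traceNorm_sub_trace_smul_le_two_mul {X : Type} [Fintype X] [DecidableEq X]
    {S T : Matrix X X ℂ} (hS : S.PosSemidef) (hT : T.PosSemidef) (hT1 : T.trace = 1) :
    traceNorm (S - S.trace.re • T) ≤ 2 * S.trace.re := by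
  have h := traceNorm_sub_le S (S.trace.re • T)
  rw [traceNorm_smul (posSemidef_trace_re_nonneg hS), traceNorm_of_posSemidef hS,
    traceNorm_of_posSemidef hT, hT1, Complex.one_re] at h
  linarith

theorem posSemidef_maxMixed (L : ℕ) : (maxMixed L).PosSemidef := by
  rw [maxMixed]
  refine PosSemidef.one.smul ?_
  rw [← Complex.ofReal_natCast, ← Complex.ofReal_inv]
  exact_mod_cast inv_nonneg.mpr (Nat.cast_nonneg L)

theorem trace_maxMixed {L : ℕ} (hL : 1 ≤ L) : (maxMixed L).trace = 1 := by
  rw [maxMixed, Matrix.trace_smul, Matrix.trace_one, Fintype.card_fin, smul_eq_mul,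
    inv_mul_cancel₀]
  exact_mod_cast (by omega : L ≠ 0)

omit [DecidableEq A] [DecidableEq B] [DecidableEq R] in
theorem posSemidef_maxMixed_kronecker (L : ℕ) (ψ : A × B × R → ℂ) :
    (maxMixed L ⊗ₖ reduce3 (ketbra ψ)).PosSemidef :=
  (posSemidef_maxMixed L).kronecker (posSemidef_reduce3_ketbra ψ)

omit [DecidableEq A] [DecidableEq B] [DecidableEq R] in
theorem trace_maxMixed_kronecker {L : ℕ} (hL : 1 ≤ L) {ψ : A × B × R → ℂ}
    (hψ : IsStateVector ψ) : (maxMixed L ⊗ₖ reduce3 (ketbra ψ)).trace = 1 := by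
  rw [trace_kronecker, trace_maxMixed hL, trace_reduce3_ketbra, hψ, mul_one]

omit [DecidableEq A] [DecidableEq B] [DecidableEq R] in
theorem nonempty_of_isStateVector {ψ : A × B × R → ℂ} (hψ : IsStateVector ψ) : Nonempty A := by
  by_contra h
  rw [not_nonempty_iff] at h
  simp [IsStateVector, dotProduct] at hψ

/-- The unnormalised reduced post-measurement state on `A₁R` for the Kraus operator `P`. -/
def outcomeState {X : Type} (P : Matrix X A ℂ) (ψ : A × B × R → ℂ) :
    Matrix (X × R) (X × R) ℂ :=
  reduce13 (ketbra ((P ⊗ₖ (1 : Matrix (B × R) (B × R) ℂ)) *ᵥ ψ))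

omit [DecidableEq A] in
-- Absorbing the probability into the trace norm removes the division by `p`, so the error becomes a
-- continuous function of the Kraus operators.
theorem quantumError_eq {J : Type} [Fintype J] {L : ℕ} (P : J → Matrix (Fin L) A ℂ)
    (ψ : A × B × R → ℂ) :
    quantumError P ψ = ∑ j, traceNorm (outcomeState (P j) ψ -
      (outcomeState (P j) ψ).trace.re • (maxMixed L ⊗ₖ reduce3 (ketbra ψ))) := by
  refine Finset.sum_congr rfl fun j _ => ?_
  rw [outcomeProb_mul_traceNorm, outcomeProb_eq]
  rfl

theorem continuous_outcomeState {X : Type} [Fintype X] (Q : Matrix X A ℂ) (ψ : A × B × R → ℂ) :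
    Continuous fun U : unitaryGroup A ℂ => outcomeState (Q * (U : Matrix A A ℂ)) ψ := by
  refine continuous_matrix fun x y => ?_
  simp only [outcomeState, reduce13_ketbra_kronecker]
  fun_prop

theorem continuous_trace_re {α X : Type} [TopologicalSpace α] [Fintype X]
    {f : α → Matrix X X ℂ} (hf : Continuous f) : Continuous fun a => (f a).trace.re :=
  Complex.continuous_re.comp hf.matrix_trace

theorem continuous_quantumError {J : Type} [Fintype J] {L : ℕ} (Q : J → Matrix (Fin L) A ℂ)
    (ψ : A × B × R → ℂ) :
    Continuous fun U : unitaryGroup A ℂ => quantumError (fun j => Q j * (U : Matrix A A ℂ)) ψ := by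
  simp only [quantumError_eq]
  refine continuous_finsetSum _ fun j _ => continuous_traceNorm.comp ?_
  have h := continuous_outcomeState (Q j) ψ
  exact h.sub ((continuous_trace_re h).smul continuous_const)

omit [DecidableEq A] in
-- Since `(L / d) τ = d⁻¹ 1`, the reference operator has blocks `(Tr X / d) 1`, exactly the centring
-- used in `integral_hsSq_conj_sub_le`.
theorem hsSq_outcomeState_sub {L : ℕ} (hL : 1 ≤ L) (P : Matrix (Fin L) A ℂ) (ψ : A × B × R → ℂ) :
    hsSq (outcomeState P ψ -
      (L / Fintype.card A : ℝ) • (maxMixed L ⊗ₖ reduce3 (ketbra ψ))) =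
    ∑ r, ∑ r', hsSq (P * reducedBlock ψ r r' * Pᴴ -
      ((reducedBlock ψ r r').trace / Fintype.card A) • 1) := by
  have hent : ∀ (i i' : Fin L) (r r' : R), (outcomeState P ψ -
      (L / Fintype.card A : ℝ) • (maxMixed L ⊗ₖ reduce3 (ketbra ψ))) (i, r) (i', r') =
      (P * reducedBlock ψ r r' * Pᴴ - ((reducedBlock ψ r r').trace / Fintype.card A : ℂ) •
        (1 : Matrix (Fin L) (Fin L) ℂ)) i i' := by
    intro i i' r r'
    have hL0 : (L : ℂ) ≠ 0 := by exact_mod_cast (by omega : L ≠ 0)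
    rw [Matrix.sub_apply, Matrix.sub_apply, outcomeState, reduce13_ketbra_kronecker,
      Matrix.smul_apply, Matrix.smul_apply, kroneckerMap_apply, maxMixed, Matrix.smul_apply,
      trace_reducedBlock, Complex.real_smul, smul_eq_mul, smul_eq_mul]
    congr 1
    push_cast
    field_simp
  simp only [hsSq, Fintype.sum_prod_type, hent]
  conv_lhs => rw [Finset.sum_comm]
  refine Finset.sum_congr rfl fun r _ => ?_
  conv_rhs => rw [Finset.sum_comm]
  exact Finset.sum_congr rfl fun a _ => Finset.sum_comm

theorem integral_hsSq_outcomeState_sub_le {L : ℕ} (hL : 1 ≤ L) {Q : Matrix (Fin L) A ℂ}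
    (hQ : (Qᴴ * Q) * (Qᴴ * Q) = Qᴴ * Q) (hrank : (Qᴴ * Q).rank = L) (ψ : A × B × R → ℂ) :
    ∫ U : unitaryGroup A ℂ, hsSq (outcomeState (Q * (U : Matrix A A ℂ)) ψ -
      (L / Fintype.card A : ℝ) • (maxMixed L ⊗ₖ reduce3 (ketbra ψ))) ∂(unitaryHaar A) ≤
      (L / Fintype.card A : ℝ) ^ 2 * ((reduce2 (ketbra ψ)) ^ 2).trace.re := by
  simp only [hsSq_outcomeState_sub hL]
  have hint : ∀ r r', Integrable (fun U : unitaryGroup A ℂ =>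
      hsSq (Q * (U : Matrix A A ℂ) * reducedBlock ψ r r' * (Q * (U : Matrix A A ℂ))ᴴ -
      ((reducedBlock ψ r r').trace / Fintype.card A) • 1)) (unitaryHaar A) := by
    intro r r'
    refine integrable_unitaryHaar (continuous_hsSq.comp ?_)
    fun_prop
  rw [integral_finsetSum _ fun r _ => integrable_finsetSum _ fun r' _ => hint r r',
    trace_reduce2_sq, ← sum_hsSq_reducedBlock, Finset.mul_sum]
  refine Finset.sum_le_sum fun r _ => ?_
  rw [integral_finsetSum _ fun r' _ => hint r r', Finset.mul_sum]
  refine Finset.sum_le_sum fun r' _ => ?_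
  have := integral_hsSq_conj_sub_le hQ (by rw [hrank, Fintype.card_fin])
    (by rwa [Fintype.card_fin]) (reducedBlock ψ r r')
  rwa [Fintype.card_fin] at this

/-- Jensen's inequality by way of the tangent line of the root at `s²`: `√f ≤ s / 2 + f / (2 s)`. -/
theorem integral_sqrt_le {f : unitaryGroup A ℂ → ℝ} (hf : Continuous f) (h0 : ∀ U, 0 ≤ f U)
    {s : ℝ} (hs : 0 < s) (h : ∫ U, f U ∂(unitaryHaar A) ≤ s ^ 2) :
    ∫ U, Real.sqrt (f U) ∂(unitaryHaar A) ≤ s := by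
  have hfi := integrable_unitaryHaar hf
  have hpt : ∀ U, Real.sqrt (f U) ≤ s / 2 + f U / (2 * s) := by
    intro U
    have h1 := Real.sq_sqrt (h0 U)
    have h2 := sq_nonneg (Real.sqrt (f U) - s)
    rw [div_add_div _ _ two_ne_zero (by positivity), le_div_iff₀ (by positivity)]
    nlinarith
  calc _ ≤ ∫ U, (s / 2 + f U / (2 * s)) ∂(unitaryHaar A) :=
        integral_mono (integrable_unitaryHaar hf.sqrt)
          ((integrable_const _).add (hfi.div_const _)) hpt
    _ = s / 2 + (∫ U, f U ∂(unitaryHaar A)) / (2 * s) := by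
        rw [integral_add (integrable_const _) (hfi.div_const _), integral_div (2 * s)]
        simp
    _ ≤ s / 2 + s ^ 2 / (2 * s) := by gcongr
    _ = s := by field_simp; ring

theorem integral_traceNorm_outcomeState_sub_le {L : ℕ} (hL : 1 ≤ L) {Q : Matrix (Fin L) A ℂ}
    (hQ : (Qᴴ * Q) * (Qᴴ * Q) = Qᴴ * Q) (hrank : (Qᴴ * Q).rank = L) {ψ : A × B × R → ℂ}
    (hψ : IsStateVector ψ) {D : ℝ} (hD : 0 < D)
    (hB : ((reduce2 (ketbra ψ)) ^ 2).trace.re ≤ 1 / D) :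
    ∫ U : unitaryGroup A ℂ, traceNorm (outcomeState (Q * (U : Matrix A A ℂ)) ψ -
      (outcomeState (Q * (U : Matrix A A ℂ)) ψ).trace.re • (maxMixed L ⊗ₖ reduce3 (ketbra ψ)))
        ∂(unitaryHaar A) ≤
      2 * (L / Fintype.card A * Real.sqrt (L * (Fintype.card R / D))) := by
  have hA := nonempty_of_isStateVector hψ
  have hd : (0 : ℝ) < Fintype.card A := by exact_mod_cast Fintype.card_pos
  have hL' : (0 : ℝ) < L := by exact_mod_cast hL
  set c : ℝ := L / Fintype.card A with hc
  have hc0 : 0 < c := div_pos hL' hd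
  set T := maxMixed L ⊗ₖ reduce3 (ketbra ψ) with hT
  have hcont := continuous_outcomeState Q ψ
  have hcsub : Continuous fun U : unitaryGroup A ℂ =>
      hsSq (outcomeState (Q * (U : Matrix A A ℂ)) ψ - c • T) :=
    continuous_hsSq.comp (hcont.sub continuous_const)
  have hs : 0 < c * Real.sqrt (1 / D) := mul_pos hc0 (Real.sqrt_pos.mpr (by positivity))
  have hsq := integral_sqrt_le hcsub (fun U => hsSq_nonneg _) hs (by
    refine (integral_hsSq_outcomeState_sub_le hL hQ hrank ψ).trans ?_
    rw [mul_pow, Real.sq_sqrt (by positivity)]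
    exact mul_le_mul_of_nonneg_left hB (sq_nonneg _))
  have hpt : ∀ U : unitaryGroup A ℂ, traceNorm (outcomeState (Q * (U : Matrix A A ℂ)) ψ -
      (outcomeState (Q * (U : Matrix A A ℂ)) ψ).trace.re • T) ≤
      2 * Real.sqrt (L * Fintype.card R) *
        Real.sqrt (hsSq (outcomeState (Q * (U : Matrix A A ℂ)) ψ - c • T)) := by
    intro U
    have h1 := traceNorm_sub_trace_smul_le (S := outcomeState (Q * (U : Matrix A A ℂ)) ψ)
      (posSemidef_maxMixed_kronecker L ψ) (trace_maxMixed_kronecker hL hψ) c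
    have h2 := traceNorm_le_sqrt_card_mul (outcomeState (Q * (U : Matrix A A ℂ)) ψ - c • T)
    rw [Fintype.card_prod, Fintype.card_fin, Nat.cast_mul] at h2
    linarith
  calc _ ≤ ∫ U : unitaryGroup A ℂ, 2 * Real.sqrt (L * Fintype.card R) *
        Real.sqrt (hsSq (outcomeState (Q * (U : Matrix A A ℂ)) ψ - c • T)) ∂(unitaryHaar A) := by
        refine integral_mono (integrable_unitaryHaar (continuous_traceNorm.comp ?_))
          ((integrable_unitaryHaar hcsub.sqrt).const_mul _) hpt
        exact hcont.sub ((continuous_trace_re hcont).smul continuous_const)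
    _ ≤ 2 * Real.sqrt (L * Fintype.card R) * (c * Real.sqrt (1 / D)) := by
        rw [integral_const_mul]
        exact mul_le_mul_of_nonneg_left hsq (by positivity)
    _ = _ := by
        have : (L : ℝ) * (Fintype.card R / D) = L * Fintype.card R * (1 / D) := by ring
        rw [this, Real.sqrt_mul (by positivity : (0 : ℝ) ≤ L * Fintype.card R)]
        ring

theorem integral_trace_outcomeState {X : Type} [Fintype X] [DecidableEq X] (Q : Matrix X A ℂ)
    {ψ : A × B × R → ℂ} (hψ : IsStateVector ψ) :
    ∫ U : unitaryGroup A ℂ, (outcomeState (Q * (U : Matrix A A ℂ)) ψ).trace.re ∂(unitaryHaar A) =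
      ((Qᴴ * Q).trace / Fintype.card A).re := by
  have h : ∀ U : unitaryGroup A ℂ, (outcomeState (Q * (U : Matrix A A ℂ)) ψ).trace =
      (rotated (Qᴴ * Q) U * ∑ r, reducedBlock ψ r r).trace := by
    intro U
    rw [← trace_conj_mul_coe, Matrix.trace, Fintype.sum_prod_type, Finset.sum_comm,
      Matrix.mul_sum, Matrix.sum_mul, Matrix.trace_sum]
    simp only [outcomeState, diag_apply, reduce13_ketbra_kronecker]
    rfl
  have hX : (∑ r, reducedBlock ψ r r).trace = 1 := by
    rw [Matrix.trace_sum]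
    simp only [trace_reducedBlock]
    exact (trace_reduce3_ketbra ψ).trans hψ
  have hc : Continuous fun U : unitaryGroup A ℂ =>
      (rotated (Qᴴ * Q) U * ∑ r, reducedBlock ψ r r).trace := by
    have := continuous_rotated (Qᴴ * Q)
    fun_prop
  have h2 := integral_re (integrable_unitaryHaar hc)
  simp only [RCLike.re_eq_complex_re] at h2
  simp only [h]
  rw [h2, integral_trace_rotated_mul, hX, mul_one]

/-- A randomly rotated measurement has small quantum error on average. -/
theorem integral_quantumError_le {L : ℕ} (hL : 1 ≤ L)
    {Q : Option (Fin (Fintype.card A / L)) → Matrix (Fin L) A ℂ} (hQ : IsRankMeasurement Q)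
    {ψ : A × B × R → ℂ} (hψ : IsStateVector ψ) {D : ℝ} (hD : 0 < D)
    (hB : ((reduce2 (ketbra ψ)) ^ 2).trace.re ≤ 1 / D) :
    ∫ U : unitaryGroup A ℂ, quantumError (fun j => Q j * (U : Matrix A A ℂ)) ψ
        ∂(unitaryHaar A) ≤ errorBound L (Fintype.card A) (Fintype.card R) D := by
  have hA := nonempty_of_isStateVector hψ
  have hd : (0 : ℝ) < Fintype.card A := by exact_mod_cast Fintype.card_pos
  have hidem : ∀ j, ((Q j)ᴴ * Q j) * ((Q j)ᴴ * Q j) = (Q j)ᴴ * Q j :=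
    fun j => (hQ.proj j).isIdempotentElem
  have hcont : ∀ j, Continuous fun U : unitaryGroup A ℂ =>
      traceNorm (outcomeState (Q j * (U : Matrix A A ℂ)) ψ -
      (outcomeState (Q j * (U : Matrix A A ℂ)) ψ).trace.re •
        (maxMixed L ⊗ₖ reduce3 (ketbra ψ))) := by
    intro j
    have h := continuous_outcomeState (Q j) ψ
    exact continuous_traceNorm.comp (h.sub ((continuous_trace_re h).smul continuous_const))
  -- The leftover outcome need not be decoupled. Its term is at most twice its probability, which
  -- has mean `(d mod L) / d`.
  have hnone : ∫ U : unitaryGroup A ℂ, traceNorm (outcomeState (Q none * (U : Matrix A A ℂ)) ψ -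
      (outcomeState (Q none * (U : Matrix A A ℂ)) ψ).trace.re •
        (maxMixed L ⊗ₖ reduce3 (ketbra ψ))) ∂(unitaryHaar A) ≤ 2 * (L / Fintype.card A) := by
    have hc := continuous_trace_re (continuous_outcomeState (Q none) ψ)
    have hmono := integral_mono (integrable_unitaryHaar (hcont none))
      ((integrable_unitaryHaar hc).const_mul 2)
      (fun U => traceNorm_sub_trace_smul_le_two_mul (posSemidef_reduce13_ketbra _)
        (posSemidef_maxMixed_kronecker L ψ) (trace_maxMixed_kronecker hL hψ))
    refine hmono.trans ?_
    rw [integral_const_mul, integral_trace_outcomeState _ hψ,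
      trace_eq_rank_of_isIdempotentElem (hidem none), hQ.rank_none, ← Complex.ofReal_natCast,
      ← Complex.ofReal_natCast, ← Complex.ofReal_div, Complex.ofReal_re]
    gcongr
    have h1 := Nat.mod_lt (Fintype.card A) (by omega : L > 0)
    have h2 := Nat.div_add_mod' (Fintype.card A) L
    omega
  simp only [quantumError_eq]
  rw [integral_finsetSum _ fun j _ => integrable_unitaryHaar (hcont j), Fintype.sum_option]
  have hsome : ∀ j ∈ (Finset.univ : Finset (Fin (Fintype.card A / L))), _ ≤ _ := fun j _ =>
    integral_traceNorm_outcomeState_sub_le hL (hidem (some j)) (hQ.rank_some j) hψ hD hB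
  have hsum := Finset.sum_le_card_nsmul _ _ _ hsome
  rw [Finset.card_univ, Fintype.card_fin, nsmul_eq_mul] at hsum
  -- The `N` rank-`L` outcomes each contribute a weight `L / d`, in total at most 1.
  have hN : ((Fintype.card A / L : ℕ) : ℝ) * (L / Fintype.card A) ≤ 1 := by
    rw [← mul_div_assoc, div_le_one hd]
    exact_mod_cast Nat.div_mul_le_self _ _
  have hs := Real.sqrt_nonneg (L * (Fintype.card R / D))
  rw [errorBound]
  nlinarith [mul_le_mul_of_nonneg_right hN hs]

end AverageError

/-! ### Existence of rank measurements -/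

section Existence

variable {A : Type} [Fintype A] [DecidableEq A]

theorem IsRankMeasurement.mul_unitary {L : ℕ}
    {Q : Option (Fin (Fintype.card A / L)) → Matrix (Fin L) A ℂ} (hQ : IsRankMeasurement Q)
    (U : unitaryGroup A ℂ) : IsRankMeasurement fun j => Q j * (U : Matrix A A ℂ) := by
  have hidem : ∀ j, ((Q j)ᴴ * Q j) * ((Q j)ᴴ * Q j) = (Q j)ᴴ * Q j :=
    fun j => (hQ.proj j).isIdempotentElem
  have hrank : ∀ j, ((Q j * (U : Matrix A A ℂ))ᴴ * (Q j * (U : Matrix A A ℂ))).rank =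
      ((Q j)ᴴ * Q j).rank := by
    intro j
    have h1 := trace_eq_rank_of_isIdempotentElem (hidem j)
    have h2 := trace_eq_rank_of_isIdempotentElem (rotated_mul_self (hidem j) U)
    rw [trace_rotated, h1] at h2
    rw [conj_mul_coe_eq_rotated]
    exact_mod_cast h2.symm
  refine ⟨fun j => ⟨?_, ?_⟩, fun j => ?_, ?_, ?_⟩
  · rw [conj_mul_coe_eq_rotated]
    exact rotated_mul_self (hidem j) U
  · exact isHermitian_conjTranspose_mul_self _
  · rw [hrank, hQ.rank_some]
  · rw [hrank, hQ.rank_none]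
  · simp only [conj_mul_coe_eq_rotated, rotated]
    rw [← Finset.sum_mul, ← Finset.mul_sum, hQ.complete, Matrix.mul_one, conjTranspose_mul_coe]

/-- The Kraus operator mapping the `L` basis vectors numbered `s, …, s + L - 1` to the standard
basis. -/
def blockKraus (L s : ℕ) : Matrix (Fin L) A ℂ :=
  fun i a => if (Fintype.equivFin A a : ℕ) = s + i then 1 else 0

theorem blockKraus_conjTranspose_mul_self (L s : ℕ) :
    (blockKraus L s : Matrix (Fin L) A ℂ)ᴴ * blockKraus L s =
      diagonal fun a => if s ≤ Fintype.equivFin A a ∧ (Fintype.equivFin A a : ℕ) < s + L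
        then 1 else 0 := by
  ext a a'
  rw [Matrix.mul_apply, diagonal_apply]
  simp only [conjTranspose_apply, blockKraus]
  by_cases h : a = a'
  · subst h
    rw [if_pos rfl]
    split_ifs with hs
    · rw [Finset.sum_eq_single ⟨(Fintype.equivFin A a : ℕ) - s, by omega⟩]
      · rw [if_pos (by simp only []; omega)]
        simp
      · intro i _ hi
        rw [if_neg]
        · simp
        · intro h
          exact hi (Fin.ext (by simp only []; omega))
      · simp
    · refine Finset.sum_eq_zero fun i _ => ?_
      rw [if_neg]
      · simp
      · intro h
        have := i.isLt
        omega
  · rw [if_neg h]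
    refine Finset.sum_eq_zero fun i _ => ?_
    by_cases h1 : (Fintype.equivFin A a : ℕ) = s + i
    · have h2 : (Fintype.equivFin A a' : ℕ) ≠ s + i := fun h2 =>
        h ((Fintype.equivFin A).injective (Fin.ext (h1.trans h2.symm)))
      rw [if_neg h2, mul_zero]
    · rw [if_neg h1, star_zero, zero_mul]

/-- `t` is where the block really ends: at `s + L` for a full block, at the dimension of `A` for one
that overhangs the basis. -/
theorem rank_blockKraus_conjTranspose_mul_self (L s t : ℕ) (htL : t ≤ s + L)
    (htA : t ≤ Fintype.card A) (ht : t = s + L ∨ t = Fintype.card A) :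
    ((blockKraus L s : Matrix (Fin L) A ℂ)ᴴ * (blockKraus L s : Matrix (Fin L) A ℂ)).rank =
      t - s := by
  rw [blockKraus_conjTranspose_mul_self, rank_diagonal, ← Nat.card_Ico, ← Fintype.card_coe]
  refine Fintype.card_congr ⟨fun a => ⟨Fintype.equivFin A a.1, ?_⟩,
    fun x => ⟨(Fintype.equivFin A).symm ⟨x.1, ?_⟩, ?_⟩, fun a => ?_, fun x => ?_⟩
  · have := a.2
    have h2 := (Fintype.equivFin A a.1).isLt
    simp only [ne_eq, ite_eq_right_iff, one_ne_zero, imp_false, not_not] at this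
    rw [Finset.mem_Ico]
    omega
  · have := Finset.mem_Ico.mp x.2
    omega
  · have := Finset.mem_Ico.mp x.2
    simp
    omega
  · simp
  · simp

theorem exists_isRankMeasurement (A : Type) [Fintype A] [DecidableEq A] {L : ℕ} (hL : 1 ≤ L) :
    ∃ Q : Option (Fin (Fintype.card A / L)) → Matrix (Fin L) A ℂ, IsRankMeasurement Q := by
  have hdiv := Nat.div_add_mod' (Fintype.card A) L
  have hmod := Nat.mod_lt (Fintype.card A) (by omega : L > 0)
  -- The outcome `none` receives block number `⌊d / L⌋`, which starts after the full blocks and is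
  -- cut off by the end of the basis.
  refine ⟨fun j => blockKraus L (j.elim (Fintype.card A / L) Fin.val * L), fun j => ⟨?_, ?_⟩,
    fun j => ?_, ?_, ?_⟩
  · rw [IsIdempotentElem, blockKraus_conjTranspose_mul_self, diagonal_mul_diagonal]
    congr 1
    ext a
    split_ifs <;> simp
  · exact isHermitian_conjTranspose_mul_self _
  · have h1 : ((j : ℕ) + 1) * L ≤ Fintype.card A / L * L := Nat.mul_le_mul_right L j.isLt
    rw [add_mul, one_mul] at h1
    rw [rank_blockKraus_conjTranspose_mul_self L _ ((j : ℕ) * L + L) (by simp)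
      (by omega) (by simp)]
    simp
  · exact rank_blockKraus_conjTranspose_mul_self L _ (Fintype.card A)
      (by simp; omega) le_rfl (by simp)
  -- The basis vector numbered `a` lies in block `⌊a / L⌋` and in no other, so the diagonal
  -- projectors sum to 1.
  · have hcond : ∀ (m : ℕ) (a : A), (m * L ≤ Fintype.equivFin A a ∧
        (Fintype.equivFin A a : ℕ) < m * L + L) ↔ (Fintype.equivFin A a : ℕ) / L = m := by
      intro m a
      rw [Nat.div_eq_iff (by omega)]
      omega
    ext a a'
    rw [Matrix.sum_apply]
    simp only [blockKraus_conjTranspose_mul_self, hcond, diagonal_apply, Matrix.one_apply]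
    split_ifs with h
    · have hq : (Fintype.equivFin A a : ℕ) / L ≤ Fintype.card A / L :=
        Nat.div_le_div_right (Fintype.equivFin A a).isLt.le
      let f : ℕ → ℂ := fun m => if (Fintype.equivFin A a : ℕ) / L = m then 1 else 0
      rw [Fintype.sum_option]
      change f (Fintype.card A / L) + ∑ j : Fin (Fintype.card A / L), f j = 1
      rw [add_comm, Fin.sum_univ_eq_sum_range, ← Finset.sum_range_succ, Finset.sum_ite_eq, if_pos]
      rw [Finset.mem_range]
      omega
    · simp

variable {B R : Type} [Fintype B] [DecidableEq B] [Fintype R] [DecidableEq R]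

theorem exists_quantumError_le {L : ℕ} (hL : 1 ≤ L) {ψ : A × B × R → ℂ} (hψ : IsStateVector ψ)
    {D : ℝ} (hD : 0 < D) (hB : ((reduce2 (ketbra ψ)) ^ 2).trace.re ≤ 1 / D) :
    ∃ P : Option (Fin (Fintype.card A / L)) → Matrix (Fin L) A ℂ, IsRankMeasurement P ∧
      quantumError P ψ ≤ errorBound L (Fintype.card A) (Fintype.card R) D := by
  obtain ⟨Q, hQ⟩ := exists_isRankMeasurement A hL
  obtain ⟨U, hU⟩ := exists_le_integral (integrable_unitaryHaar (continuous_quantumError Q ψ))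
  exact ⟨_, hQ.mul_unitary U, hU.trans (integral_quantumError_le hL hQ hψ hD hB)⟩

end Existence

/-! ### State merging from decoupling -/

section MergingProtocol

variable {X Y A B R : Type} [Fintype X] [DecidableEq X] [Fintype Y] [DecidableEq Y]
  [Fintype A] [DecidableEq A] [Fintype B] [DecidableEq B] [Fintype R] [DecidableEq R]

/-- The decoding isometry: if two purifications have close reduced states then an isometry on the
purifying system gives them large overlap. -/
theorem exists_isometry_overlap (hBY : Fintype.card B ≤ Fintype.card Y)
    {M : Matrix (X × R) B ℂ} {T : Matrix (X × R) Y ℂ} (hM : hsSq M = 1) (hT : hsSq T = 1) :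
    ∃ W : Matrix Y B ℂ, Wᴴ * W = 1 ∧
      1 - traceNorm (M * Mᴴ - T * Tᴴ) ≤ ‖(Tᴴ * (M * Wᵀ)).trace‖ ^ 2 := by
  obtain ⟨V, hV, h⟩ := exists_isometry_trace_sqrt_mul_sqrt_le hBY M T
  have htr : ∀ {Z : Type} [Fintype Z] (N : Matrix (X × R) Z ℂ), hsSq N = 1 →
      (N * Nᴴ).trace.re = 1 := by
    intro Z _ N hN
    rw [Matrix.trace_mul_comm, ← hsSq_eq, hN]
  have hlow := one_sub_traceNorm_le_trace_sqrt_mul_sqrt (posSemidef_self_mul_conjTranspose M)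
    (posSemidef_self_mul_conjTranspose T) (htr M hM) (htr T hT)
  -- Acting with `W` on Bob's ket multiplies the bipartite matrix by `Wᵀ` on the right, so `W` is
  -- the entrywise conjugate of the Uhlmann isometry `V`.
  refine ⟨(Vᴴ)ᵀ, ?_, ?_⟩
  · have : ((Vᴴ)ᵀ)ᴴ = Vᵀ := by
      ext i j
      simp
    rw [this, ← transpose_mul, hV, transpose_one]
  · have e : (Tᴴ * (M * (Vᴴ)ᵀᵀ)).trace = (Vᴴ * (Tᴴ * M)).trace := by
      rw [transpose_transpose, ← Matrix.mul_assoc, Matrix.trace_mul_comm]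
    rw [e]
    have hx := traceNorm_nonneg (M * Mᴴ - T * Tᴴ)
    have hn := (hlow.trans h).trans (Complex.re_le_norm (Vᴴ * (Tᴴ * M)).trace)
    set x := traceNorm (M * Mᴴ - T * Tᴴ)
    set n := ‖(Vᴴ * (Tᴴ * M)).trace‖
    have hn0 : 0 ≤ n := norm_nonneg _
    -- For `x ≤ 2`, `(1 - x / 2)² ≥ 1 - x`; for larger `x` the lower bound is negative.
    rcases le_total x 2 with h2 | h2
    · have := mul_self_le_mul_self (by linarith : 0 ≤ 1 - x / 2) hn
      nlinarith [sq_nonneg x]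
    · nlinarith [sq_nonneg n]

/-- The tripartite vector with a given matrix with respect to the bipartition `XR : Y`. -/
def uncut (N : Matrix (X × R) Y ℂ) : (X × Y) × R → ℂ := fun z => N (z.1.1, z.2) z.1.2

omit [DecidableEq X] [DecidableEq Y] [DecidableEq R] in
theorem star_uncut_dotProduct (T N : Matrix (X × R) Y ℂ) :
    star (uncut T) ⬝ᵥ uncut N = (Tᴴ * N).trace := by
  rw [trace_conjTranspose_mul]
  simp only [dotProduct, Fintype.sum_prod_type, uncut, Pi.star_apply]
  exact Finset.sum_congr rfl fun x _ => Finset.sum_comm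

/-- The matrix of the target vector of state merging with respect to the bipartition
`A₁R : B₁B'B`. -/
def targetMatrix (L : ℕ) (ψ : A × B × R → ℂ) : Matrix (Fin L × R) (Fin L × A × B) ℂ :=
  fun x y => mergeTarget L ψ ((x.1, y), x.2)

omit [Fintype A] [DecidableEq A] [Fintype B] [DecidableEq B] [Fintype R] [DecidableEq R] in
theorem uncut_targetMatrix (L : ℕ) (ψ : A × B × R → ℂ) :
    uncut (targetMatrix L ψ) = mergeTarget L ψ := rfl

omit [DecidableEq A] [DecidableEq B] [Fintype R] [DecidableEq R] in
-- Bob's systems in the target purify `τ ⊗ ρ_R`, which is why decoupling `A₁` from `R` suffices for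
-- merging.
theorem targetMatrix_mul_conjTranspose {L : ℕ} (ψ : A × B × R → ℂ) :
    targetMatrix L ψ * (targetMatrix L ψ)ᴴ = maxMixed L ⊗ₖ reduce3 (ketbra ψ) := by
  ext ⟨i, r⟩ ⟨i', r'⟩
  have hsq : ((Real.sqrt L : ℂ)⁻¹ * (Real.sqrt L : ℂ)⁻¹) = (L : ℂ)⁻¹ := by
    rw [← mul_inv, ← Complex.ofReal_mul, Real.mul_self_sqrt (Nat.cast_nonneg L),
      Complex.ofReal_natCast]
  rw [Matrix.mul_apply, kroneckerMap_apply, maxMixed, Matrix.smul_apply, Matrix.one_apply,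
    reduce3, Fintype.sum_prod_type]
  simp only [conjTranspose_apply, targetMatrix, mergeTarget, maxEntangled, ketbra,
    vecMulVec_apply, Pi.star_apply, Fintype.sum_prod_type, Finset.mul_sum]
  rw [Finset.sum_eq_single i]
  · refine Finset.sum_congr rfl fun a _ => Finset.sum_congr rfl fun b _ => ?_
    rw [if_pos rfl]
    by_cases h : i = i'
    · subst h
      rw [if_pos rfl, if_pos rfl, ← hsq]
      simp only [star_mul', star_inv₀, RCLike.star_def, Complex.conj_ofReal, smul_eq_mul]
      ring
    · rw [if_neg h, if_neg fun h' : i' = i => h h'.symm]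
      simp
  · intro k _ hk
    refine Finset.sum_eq_zero fun a _ => Finset.sum_eq_zero fun b _ => ?_
    rw [if_neg hk.symm]
    simp
  · simp

omit [DecidableEq A] [DecidableEq B] [DecidableEq R] in
theorem hsSq_targetMatrix {L : ℕ} (hL : 1 ≤ L) {ψ : A × B × R → ℂ} (hψ : IsStateVector ψ) :
    hsSq (targetMatrix L ψ) = 1 := by
  rw [hsSq_eq, Matrix.trace_mul_comm, targetMatrix_mul_conjTranspose,
    trace_maxMixed_kronecker hL hψ, Complex.one_re]

omit [DecidableEq X] in
theorem sum_outcomeProb {J : Type} [Fintype J] {P : J → Matrix X A ℂ}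
    (hP : ∑ j, (P j)ᴴ * P j = 1) {ψ : A × B × R → ℂ} (hψ : IsStateVector ψ) :
    ∑ j, outcomeProb (P j) ψ = 1 := by
  simp only [outcomeProb_eq_sum]
  rw [← Complex.re_sum, Finset.sum_comm]
  have h : ∀ r, ∑ j, (P j * reducedBlock ψ r r * (P j)ᴴ).trace = reduce3 (ketbra ψ) r r := by
    intro r
    rw [← trace_reducedBlock]
    conv_rhs => rw [← Matrix.one_mul (reducedBlock ψ r r), ← hP]
    rw [Finset.sum_mul, Matrix.trace_sum]
    refine Finset.sum_congr rfl fun j _ => ?_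
    rw [Matrix.trace_mul_comm, Matrix.mul_assoc, ← Matrix.mul_assoc]
  simp only [h]
  have := trace_reduce3_ketbra ψ
  rw [hψ] at this
  rw [← Complex.one_re, ← this]
  rfl

/-- The decoding isometry for one outcome of the measurement. -/
theorem exists_decoder {L : ℕ} (hL : 1 ≤ L) {ψ : A × B × R → ℂ} (hψ : IsStateVector ψ)
    (P : Matrix (Fin L) A ℂ) :
    ∃ W : Matrix (Fin L × A × B) B ℂ, Wᴴ * W = 1 ∧
      outcomeProb P ψ * (1 - traceNorm (reduce13 (ketbra (postState P ψ)) -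
        maxMixed L ⊗ₖ reduce3 (ketbra ψ))) ≤
      ‖((targetMatrix L ψ)ᴴ *
        (cutMatrix ((P ⊗ₖ (1 : Matrix (B × R) (B × R) ℂ)) *ᵥ ψ) * Wᵀ)).trace‖ ^ 2 := by
  have hA := nonempty_of_isStateVector hψ
  have hcard : Fintype.card B ≤ Fintype.card (Fin L × A × B) := by
    rw [Fintype.card_prod, Fintype.card_prod, Fintype.card_fin, ← mul_assoc]
    exact Nat.le_mul_of_pos_left _ (Nat.mul_pos hL Fintype.card_pos)
  have hp := outcomeProb_nonneg P ψ
  set M₀ := cutMatrix ((P ⊗ₖ (1 : Matrix (B × R) (B × R) ℂ)) *ᵥ ψ) with hM₀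
  have hT := hsSq_targetMatrix hL hψ
  have hM₀p : hsSq M₀ = outcomeProb P ψ := by
    rw [outcomeProb_eq, reduce13_ketbra, Matrix.trace_mul_comm, ← hsSq_eq]
  rcases hp.eq_or_lt with h0 | h0
  -- For probability 0 any isometry will do; the polar decomposition of 0 provides one.
  · obtain ⟨W, hW, -⟩ := exists_isometry_polar hcard (0 : Matrix (Fin L × A × B) B ℂ)
    refine ⟨W, hW, ?_⟩
    rw [← h0, zero_mul]
    positivity
  · have hcut : cutMatrix (postState P ψ) = ((Real.sqrt (outcomeProb P ψ))⁻¹ : ℂ) • M₀ := rfl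
    have hM : hsSq (cutMatrix (postState P ψ)) = 1 := by
      have : hsSq (cutMatrix (postState P ψ)) = (outcomeProb P ψ)⁻¹ * hsSq M₀ := by
        rw [hcut]
        simp only [hsSq, Matrix.smul_apply, norm_smul, mul_pow, Finset.mul_sum]
        rw [norm_inv, Complex.norm_real, Real.norm_of_nonneg (Real.sqrt_nonneg _), inv_pow,
          Real.sq_sqrt hp]
      rw [this, hM₀p, inv_mul_cancel₀ h0.ne']
    obtain ⟨W, hW, h⟩ := exists_isometry_overlap hcard hM hT
    refine ⟨W, hW, ?_⟩
    rw [← reduce13_ketbra, targetMatrix_mul_conjTranspose, hcut, Matrix.smul_mul,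
      Matrix.mul_smul, Matrix.trace_smul, norm_smul, mul_pow, norm_inv, Complex.norm_real,
      Real.norm_of_nonneg (Real.sqrt_nonneg _), inv_pow, Real.sq_sqrt hp] at h
    have := mul_le_mul_of_nonneg_left h hp
    rwa [mul_inv_cancel_left₀ h0.ne'] at this

omit [Fintype Y] [DecidableEq X] [DecidableEq Y] [Fintype R] [DecidableEq R] in
theorem tensorId_conjMap_ketbra (K : Matrix Y X ℂ) (v : X × R → ℂ) :
    tensorId (conjMap K) (ketbra v) = ketbra fun y => ∑ x, K y.1 x * v (x, y.2) := by
  ext y z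
  change (K * Matrix.of (fun x x' => v (x, y.2) * star (v (x', z.2))) * Kᴴ) y.1 z.1 = _
  simp only [ketbra, vecMulVec_apply, Pi.star_apply, Matrix.mul_apply, conjTranspose_apply,
    of_apply, star_sum, star_mul', Finset.sum_mul, Finset.mul_sum]
  exact Finset.sum_congr rfl fun a _ => Finset.sum_congr rfl fun b _ => by ring

omit [Fintype X] [DecidableEq X] [Fintype Y] [DecidableEq Y] [Fintype R] [DecidableEq R] in
theorem tensorId_sum {J : Type} [Fintype J] (M : J → (Matrix X X ℂ →ₗ[ℂ] Matrix Y Y ℂ))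
    (ρ : Matrix (X × R) (X × R) ℂ) : tensorId (∑ j, M j) ρ = ∑ j, tensorId (M j) ρ := by
  ext y z
  rw [Matrix.sum_apply]
  change (∑ j, M j) (Matrix.of fun x x' => ρ (x, y.2) (x', z.2)) y.1 z.1 = _
  rw [LinearMap.sum_apply, Matrix.sum_apply]
  rfl

omit [DecidableEq X] [DecidableEq Y] in
theorem conjMap_comp {Z : Type} [Fintype Z] (K : Matrix Z Y ℂ) (K' : Matrix Y X ℂ) :
    conjMap K ∘ₗ conjMap K' = conjMap (K * K') := by
  ext1 M
  simp [conjMap, conjTranspose_mul, Matrix.mul_assoc]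

/-- The merging protocol: Alice measures with Kraus operators `P j`, and Bob applies the isometry
`W j` depending on the outcome. -/
def protocol {L : ℕ} {J : Type} [Fintype J] (P : J → Matrix (Fin L) A ℂ)
    (W : J → Matrix (Fin L × A × B) B ℂ) :
    Matrix ((A × Fin 1) × (B × Fin 1)) ((A × Fin 1) × (B × Fin 1)) ℂ →ₗ[ℂ]
      Matrix (Fin L × (Fin L × A × B)) (Fin L × (Fin L × A × B)) ℂ :=
  -- The sum over `Unit` presents Bob's isometry as a measurement with a single outcome, the form
  -- required by `IsLOCC.bob`.
  ∑ j, (∑ _ : Unit, LinearMap.id ∘ₗ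
      conjMap ((1 : Matrix (Fin L) (Fin L) ℂ) ⊗ₖ (W j).submatrix id Prod.fst)) ∘ₗ
    conjMap ((P j).submatrix id Prod.fst ⊗ₖ (1 : Matrix (B × Fin 1) (B × Fin 1) ℂ))

omit [DecidableEq X] [Fintype A] [DecidableEq A] in
theorem submatrix_fst_conjTranspose_mul_self (P : Matrix X A ℂ) :
    (P.submatrix id (Prod.fst : A × Fin 1 → A))ᴴ * P.submatrix id (Prod.fst : A × Fin 1 → A) =
      (Pᴴ * P).submatrix Prod.fst Prod.fst := by
  ext x y
  simp [Matrix.mul_apply]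

omit [Fintype A] in
theorem one_submatrix_fst :
    (1 : Matrix A A ℂ).submatrix (Prod.fst : A × Fin 1 → A)
      (Prod.fst : A × Fin 1 → A) = 1 := by
  ext x y
  simp [Matrix.one_apply, Prod.ext_iff, Subsingleton.elim x.2 y.2]

theorem isLOCC_protocol {L : ℕ} {J : Type} [Fintype J] {P : J → Matrix (Fin L) A ℂ}
    {W : J → Matrix (Fin L × A × B) B ℂ} (hP : ∑ j, (P j)ᴴ * P j = 1)
    (hW : ∀ j, (W j)ᴴ * W j = 1) :
    IsLOCC (Fin L) (Fin L × A × B) (A × Fin 1) (B × Fin 1) (protocol P W) := by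
  refine IsLOCC.alice (fun j => (P j).submatrix id Prod.fst) ?_ _ fun j =>
    IsLOCC.bob (fun _ : Unit => (W j).submatrix id Prod.fst) ?_ _ fun _ => IsLOCC.done
  · simp only [submatrix_fst_conjTranspose_mul_self]
    rw [← one_submatrix_fst, ← hP]
    ext x y
    simp [Matrix.sum_apply]
  · simp only [submatrix_fst_conjTranspose_mul_self, hW, one_submatrix_fst]
    simp

omit [DecidableEq A] in
theorem mergeOutput_protocol {L : ℕ} {J : Type} [Fintype J] (P : J → Matrix (Fin L) A ℂ)
    (W : J → Matrix (Fin L × A × B) B ℂ) (ψ : A × B × R → ℂ) :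
    mergeOutput ψ (protocol P W) = ∑ j, ketbra (uncut
      (cutMatrix ((P j ⊗ₖ (1 : Matrix (B × R) (B × R) ℂ)) *ᵥ ψ) * (W j)ᵀ)) := by
  rw [mergeOutput, protocol, tensorId_sum]
  refine Finset.sum_congr rfl fun j _ => ?_
  simp only [Finset.univ_unique, Finset.sum_singleton, LinearMap.id_comp]
  rw [conjMap_comp, ← mul_kronecker_mul, Matrix.one_mul, Matrix.mul_one, tensorId_conjMap_ketbra]
  congr 1
  ext ⟨⟨i, y⟩, r⟩
  simp only [uncut, Matrix.mul_apply, cutMatrix, kronecker_one_mulVec_apply, transpose_apply,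
    Fintype.sum_prod_type, kroneckerMap_apply, submatrix_apply, mergeInput, maxEntangled,
    Finset.univ_unique, Finset.sum_singleton, Finset.sum_mul]
  rw [Finset.sum_comm]
  refine Finset.sum_congr rfl fun b _ => Finset.sum_congr rfl fun a _ => ?_
  simp
  ring

omit [DecidableEq X] [DecidableEq Y] in
theorem hsSq_mul_transpose {W : Matrix Y B ℂ} (hW : Wᴴ * W = 1) (M : Matrix X B ℂ) :
    hsSq (M * Wᵀ) = hsSq M := by
  have h : Wᵀ * (Wᵀ)ᴴ = 1 := by
    rw [← transpose_one, ← hW, transpose_mul]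
    rfl
  rw [← hsSq_conjTranspose, hsSq_eq, conjTranspose_conjTranspose, conjTranspose_mul,
    Matrix.mul_assoc, ← Matrix.mul_assoc Wᵀ, h, Matrix.one_mul, Matrix.trace_mul_comm, ← hsSq_eq]

omit [DecidableEq X] in
theorem star_dotProduct_sum_ketbra_mulVec {J : Type} [Fintype J] (v : J → X → ℂ) (t : X → ℂ) :
    (star t ⬝ᵥ ((∑ j, ketbra (v j)) *ᵥ t)).re = ∑ j, ‖star t ⬝ᵥ v j‖ ^ 2 := by
  rw [sum_mulVec, dotProduct_sum, Complex.re_sum]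
  refine Finset.sum_congr rfl fun j _ => ?_
  rw [ketbra, vecMulVec_mulVec, dotProduct_smul, ← Complex.ofReal_re (‖star t ⬝ᵥ v j‖ ^ 2),
    Complex.ofReal_pow, ← Complex.mul_conj', ← RCLike.star_def, star_dotProduct, op_smul_eq_mul]

/-- A measurement with small quantum error yields a state merging protocol with small error. -/
theorem exists_isStateMerging {L : ℕ} (hL : 1 ≤ L) {ψ : A × B × R → ℂ} (hψ : IsStateVector ψ)
    {J : Type} [Fintype J] {P : J → Matrix (Fin L) A ℂ} (hP : ∑ j, (P j)ᴴ * P j = 1) {β : ℝ}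
    (hβ : quantumError P ψ ≤ β) :
    ∃ M : Matrix ((A × Fin 1) × (B × Fin 1)) ((A × Fin 1) × (B × Fin 1)) ℂ →ₗ[ℂ]
        Matrix (Fin L × (Fin L × A × B)) (Fin L × (Fin L × A × B)) ℂ,
      IsStateMerging ψ M (2 * Real.sqrt β) ∧
      traceNorm (mergeOutput ψ M - ketbra (mergeTarget L ψ)) ≤ 2 * Real.sqrt β := by
  choose W hW hov using fun j => exists_decoder hL hψ (P j)
  have hout := mergeOutput_protocol P W ψ
  set ρ := mergeOutput ψ (protocol P W) with hρ
  have hpsd : ρ.PosSemidef := by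
    rw [hout]
    exact posSemidef_sum _ fun j _ => posSemidef_ketbra _
  have htr : ρ.trace.re = 1 := by
    rw [hout, Matrix.trace_sum, Complex.re_sum, ← sum_outcomeProb hP hψ]
    refine Finset.sum_congr rfl fun j _ => ?_
    rw [trace_ketbra, star_uncut_dotProduct, ← hsSq_eq, hsSq_mul_transpose (hW j), outcomeProb_eq,
      reduce13_ketbra, Matrix.trace_mul_comm, ← hsSq_eq]
  have ht : IsStateVector (mergeTarget L ψ) := by
    rw [IsStateVector, ← uncut_targetMatrix, star_uncut_dotProduct, trace_conjTranspose_mul_self,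
      hsSq_targetMatrix hL hψ, Complex.ofReal_one]
  -- Every branch of the protocol is pure, and the fidelity with the pure target is linear in the
  -- output. The bounds for the single outcomes therefore add up to `1 - quantumError P ψ`.
  have hF : 1 - β ≤ (star (mergeTarget L ψ) ⬝ᵥ (ρ *ᵥ mergeTarget L ψ)).re := by
    rw [hout, star_dotProduct_sum_ketbra_mulVec]
    have hsum := Finset.sum_le_sum fun j (_ : j ∈ Finset.univ) => hov j
    simp only [← star_uncut_dotProduct, uncut_targetMatrix] at hsum
    refine le_trans ?_ hsum
    simp only [mul_sub, mul_one, Finset.sum_sub_distrib]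
    rw [sum_outcomeProb hP hψ]
    exact sub_le_sub_left hβ 1
  refine ⟨protocol P W, ⟨isLOCC_protocol hP hW, ?_⟩, ?_⟩
  · rw [← hρ]
    -- `β ≤ 2 √β` holds when `√β ≤ 2`; beyond that the claimed lower bound on the fidelity is
    -- negative.
    rcases le_total (Real.sqrt β) 2 with h2 | h2
    · rw [fidelity_ketbra hpsd]
      refine le_trans ?_ hF
      rcases le_total 0 β with h0 | h0
      · nlinarith [Real.mul_self_sqrt h0, Real.sqrt_nonneg β]
      · linarith [Real.sqrt_nonneg β]
    · have : 0 ≤ fidelity ρ (ketbra (mergeTarget L ψ)) := sq_nonneg _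
      linarith
  · refine (traceNorm_sub_ketbra_le hpsd htr ht).trans ?_
    gcongr
    linarith

end MergingProtocol

end

end Merging

theorem proposition2 {A B R : Type} [Fintype A] [DecidableEq A] [Fintype B] [DecidableEq B]
    [Fintype R] [DecidableEq R]
    (ψ : A × B × R → ℂ) (hψ : Merging.IsStateVector ψ)
    (D : ℝ) (hD : 0 < D)
    (hB : ((Merging.reduce2 (Merging.ketbra ψ)) ^ 2).trace.re ≤ 1 / D)
    (L : ℕ) (hL : 1 ≤ L) :
    (∃ P : Option (Fin (Fintype.card A / L)) → Matrix (Fin L) A ℂ,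
      Merging.IsRankMeasurement P ∧
      Merging.quantumError P ψ ≤ Merging.errorBound L (Fintype.card A) (Fintype.card R) D) ∧
    (∃ M : Matrix ((A × Fin 1) × (B × Fin 1)) ((A × Fin 1) × (B × Fin 1)) ℂ →ₗ[ℂ]
        Matrix (Fin L × (Fin L × A × B)) (Fin L × (Fin L × A × B)) ℂ,
      Merging.IsStateMerging ψ M
        (2 * Real.sqrt (Merging.errorBound L (Fintype.card A) (Fintype.card R) D)) ∧
      Merging.traceNorm
          (Merging.mergeOutput ψ M - Merging.ketbra (Merging.mergeTarget L ψ)) ≤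
        2 * Real.sqrt (Merging.errorBound L (Fintype.card A) (Fintype.card R) D)) ∧
    (∀ Q : Option (Fin (Fintype.card A / L)) → Matrix (Fin L) A ℂ,
      Merging.IsRankMeasurement Q →
      Integrable (fun U : unitaryGroup A ℂ =>
        Merging.quantumError (fun j => Q j * (U : Matrix A A ℂ)) ψ) (Merging.unitaryHaar A) ∧
      ∫ U : unitaryGroup A ℂ, Merging.quantumError (fun j => Q j * (U : Matrix A A ℂ)) ψ
          ∂(Merging.unitaryHaar A) ≤
        Merging.errorBound L (Fintype.card A) (Fintype.card R) D) := by
  obtain ⟨P, hP, hPβ⟩ := Merging.exists_quantumError_le hL hψ hD hB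
  exact ⟨⟨P, hP, hPβ⟩, Merging.exists_isStateMerging hL hψ hP.complete hPβ, fun Q hQ =>
    ⟨Merging.integrable_unitaryHaar (Merging.continuous_quantumError Q ψ),
      Merging.integral_quantumError_le hL hQ hψ hD hB⟩⟩
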